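/- **Setting.** Let $t_0<t_f$, $I=(t_0,t_f)$, $x_0\in\mathbb R^{n_x}$. For $k\in\mathbb N$ let $\mathcal G^k$ be the space of functions $g:I\times\mathbb R^{n_x}\to\mathbb R^{n_g}$ such that $g(t,\cdot)$ is $k$ times continuously differentiable for a.a. $t\in I$, $g(\cdot,x)$ is measurable for each $x$, and $$\|g\|_{\mathcal G^k}=\sum_{j=0}^k \operatorname*{ess\,sup}_{t\in I}\ \sup_{x\in\mathbb R^{n_x}}\|\partial_x^j g(t,x)\|<\infty$$ (functions that agree for a.a. $t$ and all $x$ are identified). Let $f:I\times\mathbb R^{n_x}\times\mathbb R^{n_g}\to\mathbb R^{n_x}$ satisfy the following, where $f_x,f_g$ denote the partial Jacobians. The function $f(\cdot,x,g)$ is measurable for each $(x,g)$; $f(t,\cdot,\cdot)$ is continuously differentiable for a.a. $t\in I$; there is $K>0$ such that $\|f(t,0,g)\|$, $\|f_x(t,0,g)\|$, $\|f_g(t,0,g)\|\le K(\|g\|+1)$ for a.a. $t\in I$ and all $g\in\mathbb R^{n_g}$; and for each $R>0$ there is $L(R)$ such that, for a.a. $t\in I$ and all $x_1,x_2,g_1,g_2$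 of norm at most $R$, $$\|f(t,x_1,g_1)-f(t,x_2,g_2)\|\le L(R)\,(\|x_1-x_2\|+\|g_1-g_2\|),$$ $$\|f_x(t,x_1,g_1)-f_x(t,x_2,g_2)\|+\|f_g(t,x_1,g_1)-f_g(t,x_2,g_2)\|\le L(R)\,(\|x_1-x_2\|+\|g_1-g_2\|).$$ For $g\in\mathcal G^2$ let $\mathbf x(\cdot\,;g)\in (W^{1,\infty}(I))^{n_x}$ denote the solution, when it exists, of $$\mathbf x'(t)=f\big(t,\mathbf x(t),g(t,\mathbf x(t))\big)\ \text{ for a.a. } t\in I,\qquad \mathbf x(t_0)=x_0 .$$ Let $g_\epsilon,g_*\in\mathcal G^2$, and let $\mathbf x_\epsilon\in (W^{1,\infty}(I))^{n_x}$ solve this problem for $g=g_\epsilon$. Let $\Omega\subset\mathbb R^{n_x}$ be a set with $\mathbf x_\epsilon(t)\in\Omega$ for a.a. $t\in I$, and let $\boldsymbol\epsilon:I\times\Omega\to\mathbb R^{n_g}$ satisfy, componentwise, $$|g_\epsilon(t,x)-g_*(t,x)|\le\boldsymbol\epsilon(t,x)\qquad\text{for a.a. } t\in I\text{ and all }x\in\Omega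 .$$ Let $\mathbf Q\in (L^\infty(I))^{n_x\times n_x}$ with $\mathbf Q(t)$ symmetric positive semidefinite for a.a. $t\in I$. With all derivatives of $f$ evaluated at $\big(t,\mathbf x_\epsilon(t),g_\epsilon(t,\mathbf x_\epsilon(t))\big)$, put $$\mathbf A_\epsilon(t)=f_x+f_g\,(g_\epsilon)_x(t,\mathbf x_\epsilon(t)),\qquad \mathbf B_\epsilon(t)=f_g .$$ **Theorem.** Suppose that $\boldsymbol\delta\in (L^\infty(I))^{n_g}$ and $\delta\mathbf x\in (W^{1,\infty}(I))^{n_x}$ solve the optimal control problem $$\begin{aligned}\max_{\delta\mathbf x,\,\boldsymbol\delta}\quad&\tfrac12\int_{t_0}^{t_f}\delta\mathbf x(t)^T\mathbf Q(t)\,\delta\mathbf x(t)\,dt\\ \text{s.t.}\quad&\delta\mathbf x'(t)=\mathbf A_\epsilon(t)\,\delta\mathbf x(t)+\mathbf B_\epsilon(t)\,\boldsymbol\delta(t)\quad\text{for a.a. }t\in I,\qquad \delta\mathbf x(t_0)=0,\\&-\boldsymbol\epsilon(t,\mathbf x_\epsilon(t))\le\boldsymbol\delta(t)\le\boldsymbol\epsilon(t,\mathbf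 x_\epsilon(t))\quad\text{for a.a. }t\in I,\end{aligned}$$ over all $\boldsymbol\delta\in (L^\infty(I))^{n_g}$ and $\delta\mathbf x\in (W^{1,\infty}(I))^{n_x}$. Then $\mathbf x(\cdot\,;g)$ exists and is unique for all $g$ in a neighborhood of $g_\epsilon$ in $\mathcal G^2$; the map $g\mapsto\mathbf x(\cdot\,;g)$ from $\mathcal G^2$ to $(W^{1,\infty}(I))^{n_x}$ is Fréchet differentiable at $g_\epsilon$; and its Fréchet derivative $\mathbf x_{\mathbf g}(g_\epsilon)$ satisfies $$\frac12\int_{t_0}^{t_f}[\mathbf x_{\mathbf g}(g_\epsilon)(g_\epsilon-g_*)](t)^T\,\mathbf Q(t)\,[\mathbf x_{\mathbf g}(g_\epsilon)(g_\epsilon-g_*)](t)\,dt\ \le\ \frac12\int_{t_0}^{t_f}\delta\mathbf x(t)^T\mathbf Q(t)\,\delta\mathbf x(t)\,dt .$$ -/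

import Mathlib

open MeasureTheory Set Filter Topology
open scoped ENNReal ContDiff Matrix

noncomputable section

namespace ModelODE

/-- `ℝⁿ` as `Fin n → ℝ`, with the maximum norm. The vector norm is only used up to equivalence:
the function spaces, their topologies, Fréchet derivatives and the hypotheses on the dynamics below
do not change if another norm is chosen. -/
abbrev Vec (n : ℕ) : Type := Fin n → ℝ

/-- Lebesgue measure on the open interval `I = (t₀, t_f)`. -/
abbrev intervalMeasure (t₀ tf : ℝ) : Measure ℝ := volume.restrict (Ioo t₀ tf)

/-! ### The spaces `L^∞(I)^n` and `W^{1,∞}(I)^n` -/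

/-- `L^∞(I)^n`. -/
abbrev LInf (t₀ tf : ℝ) (n : ℕ) : Type := Lp (Vec n) ∞ (intervalMeasure t₀ tf)

/-- `v` is the weak derivative of `x` on `I = (t₀, t_f)`:
`∫ φ' x = - ∫ φ v` for all test functions `φ ∈ C_c^∞(I)`. -/
def IsWeakDeriv {t₀ tf : ℝ} {n : ℕ} (x v : LInf t₀ tf n) : Prop :=
  ∀ φ : ℝ → ℝ, ContDiff ℝ ∞ φ → HasCompactSupport φ → tsupport φ ⊆ Ioo t₀ tf →
    ∫ t in Ioo t₀ tf, deriv φ t • x t = - ∫ t in Ioo t₀ tf, φ t • v t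

theorem integrable_test_smul {t₀ tf : ℝ} {n : ℕ} (x : LInf t₀ tf n) {φ : ℝ → ℝ}
    (hφ : Continuous φ) (hc : HasCompactSupport φ) :
    Integrable (fun t => φ t • x t) (intervalMeasure t₀ tf) := by
  have h1 : Integrable (x : ℝ → Vec n) (intervalMeasure t₀ tf) :=
    (Lp.memLp x).integrable le_top
  obtain ⟨C, hC⟩ := hφ.bounded_above_of_compact_support hc
  exact h1.bdd_smul C hφ.aestronglyMeasurable (ae_of_all _ hC)

theorem integrable_deriv_test_smul {t₀ tf : ℝ} {n : ℕ} (x : LInf t₀ tf n) {φ : ℝ → ℝ}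
    (hφ : ContDiff ℝ ∞ φ) (hc : HasCompactSupport φ) :
    Integrable (fun t => deriv φ t • x t) (intervalMeasure t₀ tf) :=
  integrable_test_smul x (hφ.continuous_deriv (by simp)) hc.deriv

/-- The set of pairs `(x, x')` with `x, x' ∈ L^∞(I)^n` and `x'` the weak derivative of `x`. -/
def weakDerivGraph (t₀ tf : ℝ) (n : ℕ) : Submodule ℝ (LInf t₀ tf n × LInf t₀ tf n) where
  carrier := {p | IsWeakDeriv p.1 p.2}
  zero_mem' := by
    intro φ _ _ _
    have h : ∀ ψ : ℝ → ℝ, ∫ t in Ioo t₀ tf, ψ t • (0 : LInf t₀ tf n) t = 0 := by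
      intro ψ
      refine integral_eq_zero_of_ae ?_
      filter_upwards [Lp.coeFn_zero (Vec n) ∞ (intervalMeasure t₀ tf)] with t ht
      rw [ht]
      simp
    simp only [Prod.fst_zero, Prod.snd_zero, h, neg_zero]
  add_mem' := by
    rintro ⟨x, v⟩ ⟨y, w⟩ hx hy φ hφ hc hs
    have h : ∀ (ψ : ℝ → ℝ) (a b : LInf t₀ tf n),
        Integrable (fun t => ψ t • a t) (intervalMeasure t₀ tf) →
        Integrable (fun t => ψ t • b t) (intervalMeasure t₀ tf) →
        ∫ t in Ioo t₀ tf, ψ t • (a + b : LInf t₀ tf n) t =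
          (∫ t in Ioo t₀ tf, ψ t • a t) + ∫ t in Ioo t₀ tf, ψ t • b t := by
      intro ψ a b ha hb
      rw [← integral_add ha hb]
      refine integral_congr_ae ?_
      filter_upwards [Lp.coeFn_add a b] with t ht
      simp only [ht, Pi.add_apply, smul_add]
    have e1 := hx φ hφ hc hs
    have e2 := hy φ hφ hc hs
    simp only [Prod.mk_add_mk] at e1 e2 ⊢
    rw [h _ _ _ (integrable_deriv_test_smul x hφ hc) (integrable_deriv_test_smul y hφ hc),
      h _ _ _ (integrable_test_smul v hφ.continuous hc) (integrable_test_smul w hφ.continuous hc),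
      e1, e2, neg_add]
  smul_mem' := by
    rintro c ⟨x, v⟩ hx φ hφ hc hs
    have h : ∀ (ψ : ℝ → ℝ) (a : LInf t₀ tf n),
        ∫ t in Ioo t₀ tf, ψ t • (c • a : LInf t₀ tf n) t =
          c • ∫ t in Ioo t₀ tf, ψ t • a t := by
      intro ψ a
      rw [← integral_smul]
      refine integral_congr_ae ?_
      filter_upwards [Lp.coeFn_smul c a] with t ht
      simp only [ht, Pi.smul_apply, smul_comm c]
    have e1 := hx φ hφ hc hs
    simp only [Prod.smul_mk] at e1 ⊢
    rw [h, h, e1, smul_neg]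

/-- The Sobolev space `W^{1,∞}(I)^n`, with the norm `max (‖x‖_{L^∞}) (‖x'‖_{L^∞})`.
An element carries the function together with its (unique) weak derivative. -/
abbrev W1Inf (t₀ tf : ℝ) (n : ℕ) : Type := ↥(weakDerivGraph t₀ tf n)

/-- The function `x ∈ L^∞(I)^n` underlying an element of `W^{1,∞}(I)^n`. -/
def W1Inf.fn {t₀ tf : ℝ} {n : ℕ} (x : W1Inf t₀ tf n) : LInf t₀ tf n := x.1.1

/-- The weak derivative `x' ∈ L^∞(I)^n` of an element of `W^{1,∞}(I)^n`. -/
def W1Inf.weakDeriv {t₀ tf : ℝ} {n : ℕ} (x : W1Inf t₀ tf n) : LInf t₀ tf n := x.1.2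

/-- `x(t₀) = a`, in the sense that the representative of `x` that is continuous on `[t₀, t_f]`
takes the value `a` at `t₀`. -/
def HasInitialValue {t₀ tf : ℝ} {n : ℕ} (x : W1Inf t₀ tf n) (a : Vec n) : Prop :=
  ∃ y : ℝ → Vec n, ContinuousOn y (Icc t₀ tf) ∧
    y =ᵐ[intervalMeasure t₀ tf] x.fn ∧ y t₀ = a

/-! ### The space `𝒢^k` of component functions -/

/-- The quantity `∑_{j ≤ k} ess sup_{t ∈ I} sup_x ‖∂_x^j g(t, x)‖ ∈ [0, ∞]`. -/
def modelENorm (t₀ tf : ℝ) {nx ng : ℕ} (k : ℕ) (g : ℝ → Vec nx → Vec ng) : ℝ≥0∞ :=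
  ∑ j ∈ Finset.range (k + 1),
    essSup (fun t => ⨆ x : Vec nx, ‖iteratedFDeriv ℝ j (g t) x‖ₑ) (intervalMeasure t₀ tf)

theorem modelENorm_add_le (t₀ tf : ℝ) {nx ng : ℕ} (k : ℕ) {g h : ℝ → Vec nx → Vec ng}
    (hg : ∀ᵐ t ∂intervalMeasure t₀ tf, ContDiff ℝ k (g t))
    (hh : ∀ᵐ t ∂intervalMeasure t₀ tf, ContDiff ℝ k (h t)) :
    modelENorm t₀ tf k (g + h) ≤ modelENorm t₀ tf k g + modelENorm t₀ tf k h := by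
  unfold modelENorm
  rw [← Finset.sum_add_distrib]
  refine Finset.sum_le_sum fun j hj => ?_
  refine le_trans (essSup_mono_ae ?_) (ENNReal.essSup_add_le _ _)
  have hjk : ((j : ℕ) : WithTop ℕ∞) ≤ (k : ℕ) := by
    exact_mod_cast Nat.lt_succ_iff.mp (Finset.mem_range.mp hj)
  filter_upwards [hg, hh] with t h1 h2
  refine iSup_le fun x => ?_
  rw [Pi.add_apply, Pi.add_apply,
    iteratedFDeriv_add_apply (h1.of_le hjk).contDiffAt (h2.of_le hjk).contDiffAt]
  exact (enorm_add_le (iteratedFDeriv ℝ j (g t) x) (iteratedFDeriv ℝ j (h t) x)).trans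
    (add_le_add (le_iSup (fun x => ‖iteratedFDeriv ℝ j (g t) x‖ₑ) x)
      (le_iSup (fun x => ‖iteratedFDeriv ℝ j (h t) x‖ₑ) x))

theorem modelENorm_smul (t₀ tf : ℝ) {nx ng : ℕ} (k : ℕ) (c : ℝ) {g : ℝ → Vec nx → Vec ng}
    (hg : ∀ᵐ t ∂intervalMeasure t₀ tf, ContDiff ℝ k (g t)) :
    modelENorm t₀ tf k (c • g) = ‖c‖ₑ * modelENorm t₀ tf k g := by
  unfold modelENorm
  rw [Finset.mul_sum]
  refine Finset.sum_congr rfl fun j hj => ?_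
  rw [← ENNReal.essSup_const_mul]
  refine essSup_congr_ae ?_
  have hjk : ((j : ℕ) : WithTop ℕ∞) ≤ (k : ℕ) := by
    exact_mod_cast Nat.lt_succ_iff.mp (Finset.mem_range.mp hj)
  filter_upwards [hg] with t h1
  rw [ENNReal.mul_iSup]
  refine iSup_congr fun x => ?_
  rw [Pi.smul_apply, iteratedFDeriv_const_smul_apply (h1.of_le hjk).contDiffAt, enorm_smul]

theorem modelENorm_zero (t₀ tf : ℝ) {nx ng : ℕ} (k : ℕ) :
    modelENorm t₀ tf k (0 : ℝ → Vec nx → Vec ng) = 0 := by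
  have h := modelENorm_smul t₀ tf k 0 (g := (0 : ℝ → Vec nx → Vec ng))
    (ae_of_all _ fun _ => contDiff_const)
  simpa using h

/-- The functions `g : I × ℝ^{nx} → ℝ^{ng}` such that `g(t, ·)` is `k` times continuously
differentiable for almost every `t ∈ I`, `g(·, x)` is Lebesgue measurable on `I` for every `x`, and
`∑_{j ≤ k} ess sup_{t ∈ I} sup_x ‖∂_x^j g(t, x)‖ < ∞`. Values at `t ∉ I` play no role. -/
def modelSubmodule (t₀ tf : ℝ) (nx ng k : ℕ) : Submodule ℝ (ℝ → Vec nx → Vec ng) where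
  carrier := {g | (∀ᵐ t ∂intervalMeasure t₀ tf, ContDiff ℝ k (g t)) ∧
    (∀ x, AEMeasurable (fun t => g t x) (intervalMeasure t₀ tf)) ∧
    modelENorm t₀ tf k g < ⊤}
  zero_mem' := ⟨ae_of_all _ fun _ => contDiff_const, fun _ => aemeasurable_const, by
    rw [modelENorm_zero]; exact ENNReal.zero_lt_top⟩
  add_mem' := by
    rintro g h ⟨hg1, hg2, hg3⟩ ⟨hh1, hh2, hh3⟩
    refine ⟨?_, fun x => (hg2 x).add (hh2 x),
      (modelENorm_add_le t₀ tf k hg1 hh1).trans_lt (ENNReal.add_lt_top.2 ⟨hg3, hh3⟩)⟩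
    filter_upwards [hg1, hh1] with t h1 h2 using h1.add h2
  smul_mem' := by
    rintro c g ⟨hg1, hg2, hg3⟩
    refine ⟨?_, fun x => (hg2 x).const_smul c, ?_⟩
    · filter_upwards [hg1] with t h1 using h1.const_smul c
    · rw [modelENorm_smul t₀ tf k c hg1]
      exact ENNReal.mul_lt_top enorm_lt_top hg3

/-- The vector space of functions defining `𝒢^k`, before functions that agree for almost every
`t ∈ I` are identified. -/
def ModelFun (t₀ tf : ℝ) (nx ng k : ℕ) : Type := ↥(modelSubmodule t₀ tf nx ng k)

instance (t₀ tf : ℝ) (nx ng k : ℕ) : AddCommGroup (ModelFun t₀ tf nx ng k) :=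
  inferInstanceAs (AddCommGroup ↥(modelSubmodule t₀ tf nx ng k))

instance (t₀ tf : ℝ) (nx ng k : ℕ) : Module ℝ (ModelFun t₀ tf nx ng k) :=
  inferInstanceAs (Module ℝ ↥(modelSubmodule t₀ tf nx ng k))

instance (t₀ tf : ℝ) (nx ng k : ℕ) :
    CoeFun (ModelFun t₀ tf nx ng k) (fun _ => ℝ → Vec nx → Vec ng) := ⟨Subtype.val⟩

instance (t₀ tf : ℝ) (nx ng k : ℕ) : Norm (ModelFun t₀ tf nx ng k) :=
  ⟨fun g => (modelENorm t₀ tf k g).toReal⟩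

theorem modelFun_core (t₀ tf : ℝ) (nx ng k : ℕ) :
    SeminormedSpace.Core ℝ (ModelFun t₀ tf nx ng k) where
  norm_nonneg _ := ENNReal.toReal_nonneg
  norm_smul c g := by
    change (modelENorm t₀ tf k (c • g.1)).toReal = ‖c‖ * (modelENorm t₀ tf k g.1).toReal
    rw [modelENorm_smul t₀ tf k c g.2.1, ENNReal.toReal_mul, toReal_enorm]
  norm_triangle g h := by
    change (modelENorm t₀ tf k (g.1 + h.1)).toReal ≤
      (modelENorm t₀ tf k g.1).toReal + (modelENorm t₀ tf k h.1).toReal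
    rw [← ENNReal.toReal_add g.2.2.2.ne h.2.2.2.ne]
    exact ENNReal.toReal_mono (ENNReal.add_lt_top.2 ⟨g.2.2.2, h.2.2.2⟩).ne
      (modelENorm_add_le t₀ tf k g.2.1 h.2.1)

instance (t₀ tf : ℝ) (nx ng k : ℕ) : SeminormedAddCommGroup (ModelFun t₀ tf nx ng k) :=
  SeminormedAddCommGroup.ofCore (modelFun_core t₀ tf nx ng k)

instance (t₀ tf : ℝ) (nx ng k : ℕ) : NormedSpace ℝ (ModelFun t₀ tf nx ng k) where
  norm_smul_le c g := ((modelFun_core t₀ tf nx ng k).norm_smul c g).le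

/-- The normed space `𝒢^k`: functions at distance zero, i.e. functions that agree for almost every
`t ∈ I` and all `x`, are identified. -/
abbrev ModelSpace (t₀ tf : ℝ) (nx ng k : ℕ) : Type :=
  SeparationQuotient (ModelFun t₀ tf nx ng k)

/-- The class in `𝒢^k` of a function. -/
abbrev ModelFun.toSpace {t₀ tf : ℝ} {nx ng k : ℕ} (g : ModelFun t₀ tf nx ng k) :
    ModelSpace t₀ tf nx ng k := SeparationQuotient.mk g

/-! ### The dynamics, the state and its dependence on the component function -/

/-- The standing assumptions on the dynamics `f : I × ℝ^{nx} × ℝ^{ng} → ℝ^{nx}`. -/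
structure SmoothDynamics (t₀ tf : ℝ) {nx ng : ℕ} (f : ℝ → Vec nx → Vec ng → Vec nx) : Prop where
  /-- `f` is measurable in `t` for each `(x, g)`. -/
  measurable : ∀ x g, AEMeasurable (fun t => f t x g) (intervalMeasure t₀ tf)
  /-- `f` is continuously differentiable in `(x, g)` for almost every `t`. -/
  contDiff : ∀ᵐ t ∂intervalMeasure t₀ tf,
    ContDiff ℝ 1 (fun p : Vec nx × Vec ng => f t p.1 p.2)
  /-- linear growth of `f(t, 0, g)` -/
  growth : ∃ K > 0, ∀ᵐ t ∂intervalMeasure t₀ tf, ∀ g : Vec ng, ‖f t 0 g‖ ≤ K * (‖g‖ + 1)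
  /-- `f` is Lipschitz in `(x, g)` on bounded sets, uniformly in `t`. -/
  lipschitz : ∀ R > 0, ∃ L : ℝ, ∀ᵐ t ∂intervalMeasure t₀ tf,
    ∀ (x₁ x₂ : Vec nx) (g₁ g₂ : Vec ng), ‖x₁‖ ≤ R → ‖x₂‖ ≤ R → ‖g₁‖ ≤ R → ‖g₂‖ ≤ R →
      ‖f t x₁ g₁ - f t x₂ g₂‖ ≤ L * (‖x₁ - x₂‖ + ‖g₁ - g₂‖)
  /-- linear growth of the partial Jacobians `f_x(t, 0, g)` and `f_g(t, 0, g)` -/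
  deriv_growth : ∃ K > 0, ∀ᵐ t ∂intervalMeasure t₀ tf, ∀ g : Vec ng,
    ‖fderiv ℝ (fun x => f t x g) 0‖ ≤ K * (‖g‖ + 1) ∧
    ‖fderiv ℝ (fun g' => f t 0 g') g‖ ≤ K * (‖g‖ + 1)
  /-- The partial Jacobians are Lipschitz in `(x, g)` on bounded sets, uniformly in `t`. -/
  deriv_lipschitz : ∀ R > 0, ∃ L : ℝ, ∀ᵐ t ∂intervalMeasure t₀ tf,
    ∀ (x₁ x₂ : Vec nx) (g₁ g₂ : Vec ng), ‖x₁‖ ≤ R → ‖x₂‖ ≤ R → ‖g₁‖ ≤ R → ‖g₂‖ ≤ R →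
      ‖fderiv ℝ (fun x => f t x g₁) x₁ - fderiv ℝ (fun x => f t x g₂) x₂‖ +
        ‖fderiv ℝ (fun g => f t x₁ g) g₁ - fderiv ℝ (fun g => f t x₂ g) g₂‖
      ≤ L * (‖x₁ - x₂‖ + ‖g₁ - g₂‖)

/-- `x ∈ W^{1,∞}(I)^{nx}` solves the initial value problem
`x'(t) = f(t, x(t), g(t, x(t)))` for almost every `t ∈ I`, `x(t₀) = x₀`. -/
def SolvesIVP {t₀ tf : ℝ} {nx ng k : ℕ} (f : ℝ → Vec nx → Vec ng → Vec nx) (x₀ : Vec nx)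
    (g : ModelFun t₀ tf nx ng k) (x : W1Inf t₀ tf nx) : Prop :=
  (∀ᵐ t ∂intervalMeasure t₀ tf, x.weakDeriv t = f t (x.fn t) (g t (x.fn t))) ∧
    HasInitialValue x x₀

/-- `x` is a state for the class `γ ∈ 𝒢^k`: it solves the initial value problem for a representative
of `γ` (equivalently, for every representative). -/
def IsState {t₀ tf : ℝ} {nx ng k : ℕ} (f : ℝ → Vec nx → Vec ng → Vec nx) (x₀ : Vec nx)
    (γ : ModelSpace t₀ tf nx ng k) (x : W1Inf t₀ tf nx) : Prop :=
  ∃ g : ModelFun t₀ tf nx ng k, g.toSpace = γ ∧ SolvesIVP f x₀ g x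

open Classical in
/-- The map `𝒢^k ∋ γ ↦ x(· ; γ) ∈ W^{1,∞}(I)^{nx}` that sends a component function to the solution of
the initial value problem (and to `0` if there is no solution on all of `I`). -/
def state {t₀ tf : ℝ} {nx ng k : ℕ} (f : ℝ → Vec nx → Vec ng → Vec nx) (x₀ : Vec nx)
    (γ : ModelSpace t₀ tf nx ng k) : W1Inf t₀ tf nx :=
  if h : ∃ x, IsState f x₀ γ x then h.choose else 0

/-! ### The linear quadratic optimal control problem -/

/-- `A(t) = f_x(t, x(t), g(t, x(t))) + f_g(t, x(t), g(t, x(t))) g_x(t, x(t))`. -/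
def coeffA {t₀ tf : ℝ} {nx ng k : ℕ} (f : ℝ → Vec nx → Vec ng → Vec nx)
    (g : ModelFun t₀ tf nx ng k) (x : W1Inf t₀ tf nx) (t : ℝ) : Vec nx →L[ℝ] Vec nx :=
  fderiv ℝ (fun y => f t y (g t (x.fn t))) (x.fn t) +
    (fderiv ℝ (fun z => f t (x.fn t) z) (g t (x.fn t))).comp (fderiv ℝ (g t) (x.fn t))

/-- `B(t) = f_g(t, x(t), g(t, x(t)))`. -/
def coeffB {t₀ tf : ℝ} {nx ng k : ℕ} (f : ℝ → Vec nx → Vec ng → Vec nx)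
    (g : ModelFun t₀ tf nx ng k) (x : W1Inf t₀ tf nx) (t : ℝ) : Vec ng →L[ℝ] Vec nx :=
  fderiv ℝ (fun z => f t (x.fn t) z) (g t (x.fn t))

/-- The feasible pairs `(δ, δx) ∈ L^∞(I)^{ng} × W^{1,∞}(I)^{nx}`: for almost every `t ∈ I`,
`δx'(t) = A(t) δx(t) + B(t) δ(t)` and, componentwise, `-ε(t, x(t)) ≤ δ(t) ≤ ε(t, x(t))`;
moreover `δx(t₀) = 0`. -/
def lqFeasible {t₀ tf : ℝ} {nx ng k : ℕ} (f : ℝ → Vec nx → Vec ng → Vec nx)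
    (g : ModelFun t₀ tf nx ng k) (x : W1Inf t₀ tf nx) (ε : ℝ → Vec nx → Vec ng) :
    Set (LInf t₀ tf ng × W1Inf t₀ tf nx) :=
  {p | (∀ᵐ t ∂intervalMeasure t₀ tf,
        p.2.weakDeriv t = coeffA f g x t (p.2.fn t) + coeffB f g x t (p.1 t)) ∧
      HasInitialValue p.2 0 ∧
      ∀ᵐ t ∂intervalMeasure t₀ tf, -ε t (x.fn t) ≤ p.1 t ∧ p.1 t ≤ ε t (x.fn t)}

/-- The objective `½ ∫_{t₀}^{t_f} z(t)ᵀ Q(t) z(t) dt`. -/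
def lqObjective {t₀ tf : ℝ} {nx : ℕ} (Q : ℝ → Matrix (Fin nx) (Fin nx) ℝ)
    (z : W1Inf t₀ tf nx) : ℝ :=
  (1 / 2) * ∫ t in Ioo t₀ tf, z.fn t ⬝ᵥ (Q t *ᵥ z.fn t)

/-- `(δ, δx)` solves the problem of maximizing `½ ∫ δxᵀ Q δx` over all feasible pairs. -/
def SolvesLQ {t₀ tf : ℝ} {nx ng k : ℕ} (f : ℝ → Vec nx → Vec ng → Vec nx)
    (g : ModelFun t₀ tf nx ng k) (x : W1Inf t₀ tf nx) (ε : ℝ → Vec nx → Vec ng)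
    (Q : ℝ → Matrix (Fin nx) (Fin nx) ℝ) (δ : LInf t₀ tf ng) (δx : W1Inf t₀ tf nx) : Prop :=
  (δ, δx) ∈ lqFeasible f g x ε ∧
    IsMaxOn (fun p : LInf t₀ tf ng × W1Inf t₀ tf nx => lqObjective Q p.2)
      (lqFeasible f g x ε) (δ, δx)

end ModelODE

end

noncomputable section

namespace ModelODE

/-! ### Primitives and weak derivatives -/

/-! The derivative of the state map at g_ε in a direction h is the solution z of the linearized
problem z' = A z + B h(t, x_ε(t)), z(t₀) = 0. For h = g_ε - g_* the source h(t, x_ε(t)) is bounded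
componentwise by ε(t, x_ε(t)), because x_ε(t) lies in Ω almost everywhere. Hence (h(·, x_ε), z) is
feasible for the control problem, and its objective is at most the maximum. The real work is the
differentiability of the state map.

That rests on one Grönwall estimate, `W1Inf.norm_le_of_weakDeriv_le`: if z(t₀) = 0 and |z'| ≤ L|z| +
c, then ‖z‖ ≤ C c in W^{1,∞}, with C independent of z and c. It is used with three sizes of c. With
c = 0 it gives uniqueness. With c of order ‖g - g_ε‖ it gives Lipschitz dependence, and existence
along with it: the field truncated outside a ball is globally Lipschitz, Picard iteration solves it,
and the estimate keeps the solution where the truncation is inactive (`SolvesIVP.exists_near`). With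
c of order ‖g - g_ε‖², applied to x - x_ε - z, it bounds the Taylor remainder
(`SolvesIVP.exists_norm_remainder_le`).

Weak derivatives enter only through `W1Inf.fn_ae_eq`, which turns an element of W^{1,∞} into the
primitive of its weak derivative, and `W1Inf.exists_of_weakDeriv`, its converse. -/

theorem intervalIntegrable_of_integrable {E : Type*} [NormedAddCommGroup E] {t₀ tf : ℝ}
    (hI : t₀ < tf) {v : ℝ → E} (hv : Integrable v (intervalMeasure t₀ tf)) :
    IntervalIntegrable v volume t₀ tf :=
  (intervalIntegrable_iff_integrableOn_Ioo_of_le hI.le).2 hv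

theorem intervalIntegrable_of_integrable_of_mem {E : Type*} [NormedAddCommGroup E] {t₀ tf t : ℝ}
    (hI : t₀ < tf) {v : ℝ → E} (hv : Integrable v (intervalMeasure t₀ tf)) (ht : t ∈ Icc t₀ tf) :
    IntervalIntegrable v volume t₀ t :=
  (intervalIntegrable_of_integrable hI hv).mono_set (by
    rw [uIcc_of_le hI.le, uIcc_of_le ht.1]
    exact Icc_subset_Icc_right ht.2)

theorem continuousOn_primitive {E : Type*} [NormedAddCommGroup E] [NormedSpace ℝ E] {t₀ tf : ℝ}
    (hI : t₀ < tf) {v : ℝ → E} (hv : Integrable v (intervalMeasure t₀ tf)) (a : E) :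
    ContinuousOn (fun t => a + ∫ s in t₀..t, v s) (Icc t₀ tf) := by
  have h := intervalIntegral.continuousOn_primitive_interval (μ := volume) (f := v) (a := t₀)
    (b := tf) (by
      rw [uIcc_of_le hI.le]
      exact (intervalIntegrable_iff_integrableOn_Icc_of_le hI.le).1
        (intervalIntegrable_of_integrable hI hv))
  rw [uIcc_of_le hI.le] at h
  exact continuousOn_const.add h

theorem test_eq_zero_of_notMem {t₀ tf : ℝ} {φ : ℝ → ℝ} (hs : tsupport φ ⊆ Ioo t₀ tf) {t : ℝ}
    (ht : t ∉ Ioo t₀ tf) : φ t = 0 := by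
  by_contra h
  exact ht (hs (subset_tsupport φ h))

/-- Integration by parts for absolutely continuous functions: the boundary terms vanish because the
test function is supported inside the open interval, and the primitive has derivative v almost
everywhere. -/
theorem integral_deriv_mul_primitive {t₀ tf : ℝ} (hI : t₀ < tf) {v : ℝ → ℝ}
    (hv : Integrable v (intervalMeasure t₀ tf)) (a : ℝ) {φ : ℝ → ℝ} (hφ : ContDiff ℝ ∞ φ)
    (hs : tsupport φ ⊆ Ioo t₀ tf) :
    ∫ t in Ioo t₀ tf, deriv φ t * (a + ∫ s in t₀..t, v s) = - ∫ t in Ioo t₀ tf, φ t * v t := by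
  have hv' := intervalIntegrable_of_integrable hI hv
  have h1 : AbsolutelyContinuousOnInterval φ t₀ tf :=
    ContDiffOn.absolutelyContinuousOnInterval (hφ.of_le (by simp)).contDiffOn
  have h2 : AbsolutelyContinuousOnInterval (fun t => a + ∫ s in t₀..t, v s) t₀ tf := by
    have hc : AbsolutelyContinuousOnInterval (fun _ : ℝ => a) t₀ tf :=
      ContDiffOn.absolutelyContinuousOnInterval contDiffOn_const
    exact hc.add (hv'.absolutelyContinuousOnInterval_intervalIntegral (by simp))
  have h3 := h1.integral_mul_deriv_eq_deriv_mul h2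
  rw [test_eq_zero_of_notMem hs (t := tf) (by simp), test_eq_zero_of_notMem hs (t := t₀) (by simp)]
    at h3
  have h4 : ∫ t in t₀..tf, φ t * deriv (fun t => a + ∫ s in t₀..t, v s) t
      = ∫ t in t₀..tf, φ t * v t := by
    refine intervalIntegral.integral_congr_ae ?_
    filter_upwards [hv'.ae_hasDerivAt_integral] with t ht ht'
    rw [((ht (uIoc_subset_uIcc ht') t₀ (by simp)).const_add a).deriv]
  rw [h4] at h3
  rw [← integral_Ioc_eq_integral_Ioo, ← integral_Ioc_eq_integral_Ioo,
    ← intervalIntegral.integral_of_le hI.le, ← intervalIntegral.integral_of_le hI.le, h3]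
  ring

theorem integral_deriv_smul_primitive {t₀ tf : ℝ} (hI : t₀ < tf) {n : ℕ} {v : ℝ → Vec n}
    (hv : Integrable v (intervalMeasure t₀ tf)) (a : Vec n) {φ : ℝ → ℝ} (hφ : ContDiff ℝ ∞ φ)
    (hc : HasCompactSupport φ) (hs : tsupport φ ⊆ Ioo t₀ tf) :
    ∫ t in Ioo t₀ tf, deriv φ t • (a + ∫ s in t₀..t, v s) = - ∫ t in Ioo t₀ tf, φ t • v t := by
  have hbdd : ∀ ψ : ℝ → ℝ, Continuous ψ → HasCompactSupport ψ → ∀ w : ℝ → Vec n,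
      Integrable w (intervalMeasure t₀ tf) →
      Integrable (fun t => ψ t • w t) (intervalMeasure t₀ tf) := by
    intro ψ hψ hc w hw
    obtain ⟨C, hC⟩ := hψ.bounded_above_of_compact_support hc
    exact hw.bdd_smul C hψ.aestronglyMeasurable (ae_of_all _ hC)
  have hprim : Integrable (fun t => a + ∫ s in t₀..t, v s) (intervalMeasure t₀ tf) :=
    ((continuousOn_primitive hI hv a).integrableOn_Icc).mono_set Ioo_subset_Icc_self
  ext i
  rw [Pi.neg_apply, eval_integral (fun j => Integrable.eval
      (hbdd _ (hφ.continuous_deriv (by simp)) hc.deriv _ hprim) j),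
    eval_integral (fun j => Integrable.eval (hbdd _ hφ.continuous hc _ hv) j)]
  simp only [Pi.smul_apply, smul_eq_mul, Pi.add_apply]
  rw [← integral_deriv_mul_primitive hI (hv.eval i) (a i) hφ hs]
  refine setIntegral_congr_fun measurableSet_Ioo fun t ht => ?_
  have hvt := intervalIntegrable_of_integrable_of_mem hI hv (Ioo_subset_Icc_self ht)
  have h5 : (∫ s in t₀..t, v s) i = ∫ s in t₀..t, v s i := by
    rw [intervalIntegral.integral_of_le ht.1.le, intervalIntegral.integral_of_le ht.1.le]
    exact eval_integral (fun j => Integrable.eval hvt.1 j) i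
  simp only [h5]

/-- The du Bois-Reymond lemma. -/
theorem ae_eq_const_of_integral_deriv_smul_eq_zero {t₀ tf : ℝ} (hI : t₀ < tf) {n : ℕ}
    {w : ℝ → Vec n} (hw : Integrable w (intervalMeasure t₀ tf))
    (h : ∀ φ : ℝ → ℝ, ContDiff ℝ ∞ φ → HasCompactSupport φ → tsupport φ ⊆ Ioo t₀ tf →
      ∫ t in Ioo t₀ tf, deriv φ t • w t = 0) :
    ∃ c, w =ᵐ[intervalMeasure t₀ tf] fun _ => c := by
  -- A bump of integral one supported in the middle half of the interval; it serves to correct the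
  -- mean of an arbitrary test function.
  let b : ContDiffBump ((t₀ + tf) / 2) :=
    ⟨(tf - t₀) / 8, (tf - t₀) / 4, by linarith, by linarith⟩
  set ψ₀ : ℝ → ℝ := b.normed volume with hψ₀
  have hψ₀s : ContDiff ℝ ∞ ψ₀ := b.contDiff_normed
  have hψ₀c : HasCompactSupport ψ₀ := b.hasCompactSupport_normed
  have hψ₀I : ∫ t, ψ₀ t = 1 := b.integral_normed
  have hψ₀t : tsupport ψ₀ ⊆ Ioo t₀ tf := by
    rw [hψ₀, b.tsupport_normed_eq, Real.closedBall_eq_Icc]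
    intro t ht
    simp only [b] at ht
    constructor <;> linarith [ht.1, ht.2]
  have hint : ∀ ψ : ℝ → ℝ, Continuous ψ → HasCompactSupport ψ →
      Integrable (fun t => ψ t • w t) (intervalMeasure t₀ tf) := by
    intro ψ hψ hc
    obtain ⟨C, hC⟩ := hψ.bounded_above_of_compact_support hc
    exact hw.bdd_smul C hψ.aestronglyMeasurable (ae_of_all _ hC)
  have hfull : ∀ ψ : ℝ → ℝ, tsupport ψ ⊆ Ioo t₀ tf → ∀ u : ℝ → Vec n,
      ∫ t, ψ t • u t = ∫ t in Ioo t₀ tf, ψ t • u t := by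
    intro ψ hψ u
    refine (setIntegral_eq_integral_of_forall_compl_eq_zero fun t ht => ?_).symm
    rw [test_eq_zero_of_notMem hψ ht, zero_smul]
  refine ⟨∫ t in Ioo t₀ tf, ψ₀ t • w t, ?_⟩
  set c := ∫ t in Ioo t₀ tf, ψ₀ t • w t with hcdef
  have key : ∀ᵐ t ∂volume, t ∈ Ioo t₀ tf → w t - c = 0 := by
    refine IsOpen.ae_eq_zero_of_integral_contDiff_smul_eq_zero isOpen_Ioo ?_ ?_
    · have : IntegrableOn (fun t => w t - c) (Ioo t₀ tf) := hw.sub (integrable_const c)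
      exact this.locallyIntegrableOn
    intro ψ hψ hψc hψt
    set m := ∫ t, ψ t with hm
    -- Subtracting m ψ₀ makes the integral zero, so the primitive φ of η is again a test function
    -- with support in I. The hypothesis applied to φ then reads ∫ ψ w = m c = ∫ ψ c.
    set η : ℝ → ℝ := fun t => ψ t - m * ψ₀ t with hη
    have hηs : ContDiff ℝ ∞ η := hψ.sub (contDiff_const.mul hψ₀s)
    have hψi : Integrable ψ := hψ.continuous.integrable_of_hasCompactSupport hψc
    have hψ₀i : Integrable ψ₀ := hψ₀s.continuous.integrable_of_hasCompactSupport hψ₀c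
    have hηi : Integrable η := hψi.sub (hψ₀i.const_mul m)
    have hη0 : ∫ t, η t = 0 := by
      rw [hη, integral_sub hψi (hψ₀i.const_mul m), integral_const_mul, hψ₀I, mul_one, sub_self]
    set S := tsupport ψ ∪ tsupport ψ₀ with hS
    have hSc : IsCompact S := hψc.isCompact.union hψ₀c.isCompact
    -- Nonemptiness puts `sInf S` and `sSup S` into S, hence strictly inside the interval; this is
    -- what keeps the support of φ away from the endpoints.
    have hSn : S.Nonempty := by
      by_contra hne
      have h0 : ψ₀ = 0 := by
        have : tsupport ψ₀ = ∅ := subset_empty_iff.1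
          ((subset_union_right).trans (not_nonempty_iff_eq_empty.1 hne).subset)
        exact tsupport_eq_empty_iff.1 this
      rw [h0] at hψ₀I
      simp at hψ₀I
    have hSI : S ⊆ Ioo t₀ tf := union_subset hψt hψ₀t
    have hinf := hSI (hSc.sInf_mem hSn)
    have hsup := hSI (hSc.sSup_mem hSn)
    have hηS : ∀ t ∉ S, η t = 0 := by
      intro t ht
      rw [hS, mem_union, not_or] at ht
      simp [hη, image_eq_zero_of_notMem_tsupport ht.1, image_eq_zero_of_notMem_tsupport ht.2]
    have hηl : ∀ t < sInf S, η t = 0 := fun t ht =>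
      hηS t fun hmem => absurd (csInf_le hSc.bddBelow hmem) (not_le.2 ht)
    have hηr : ∀ t, sSup S < t → η t = 0 := fun t ht =>
      hηS t fun hmem => absurd (le_csSup hSc.bddAbove hmem) (not_le.2 ht)
    set φ : ℝ → ℝ := fun t => ∫ s in t₀..t, η s with hφdef
    have hφd : ∀ t, HasDerivAt φ (η t) t := fun t =>
      intervalIntegral.integral_hasDerivAt_right hηi.intervalIntegrable
        (hηs.continuous.stronglyMeasurableAtFilter _ _) hηs.continuous.continuousAt
    have hφd' : deriv φ = η := funext fun t => (hφd t).deriv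
    have hφs : ContDiff ℝ ∞ φ := by
      rw [contDiff_infty_iff_deriv, hφd']
      exact ⟨fun t => (hφd t).differentiableAt, hηs⟩
    have hleft : ∀ t, t < sInf S → φ t = 0 := by
      intro t ht
      refine intervalIntegral.integral_zero_ae (ae_of_all _ fun s hs => hηl s ?_)
      have := (uIoc_subset_uIcc hs).2
      exact lt_of_le_of_lt this (max_lt hinf.1 ht)
    have hright : ∀ t, sSup S < t → φ t = 0 := by
      intro t ht
      have e1 : ∫ s in Iic t₀, η s = 0 :=
        setIntegral_eq_zero_of_forall_eq_zero fun s hs => hηl s (lt_of_le_of_lt hs hinf.1)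
      have e2 : ∫ s in Ioi t, η s = 0 :=
        setIntegral_eq_zero_of_forall_eq_zero fun s hs => hηr s (ht.trans hs)
      have e3 := intervalIntegral.integral_Iic_sub_Iic (f := η) (a := t₀) (b := t) (μ := volume)
        hηi.integrableOn hηi.integrableOn
      have e4 := intervalIntegral.integral_Iic_add_Ioi (f := η) (b := t) (μ := volume)
        hηi.integrableOn hηi.integrableOn
      rw [hφdef]
      simp only
      rw [← e3, e1, sub_zero, ← hη0, ← e4, e2, add_zero]
    have hφsub : tsupport φ ⊆ Icc (sInf S) (sSup S) := by
      refine closure_minimal (fun t ht => ?_) isClosed_Icc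
      by_contra hn
      rw [mem_Icc, not_and_or, not_le, not_le] at hn
      exact ht (hn.elim (hleft t) (hright t))
    have hφc : HasCompactSupport φ := isCompact_Icc.of_isClosed_subset (isClosed_tsupport φ) hφsub
    have hφI : tsupport φ ⊆ Ioo t₀ tf := hφsub.trans fun t ht =>
      ⟨lt_of_lt_of_le hinf.1 ht.1, lt_of_le_of_lt ht.2 hsup.2⟩
    have h0 := h φ hφs hφc hφI
    rw [hφd'] at h0
    have e5 : ∫ t in Ioo t₀ tf, η t • w t = (∫ t in Ioo t₀ tf, ψ t • w t) - m • c := by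
      have hi : Integrable (fun t => m • ψ₀ t • w t) (intervalMeasure t₀ tf) :=
        (hint ψ₀ hψ₀s.continuous hψ₀c).smul m
      rw [hcdef, ← integral_smul, ← integral_sub (hint ψ hψ.continuous hψc) hi]
      refine integral_congr_ae (ae_of_all _ fun t => ?_)
      simp only [hη, sub_smul, mul_smul]
    have e6 : ∫ t, ψ t • (w t - c) = (∫ t in Ioo t₀ tf, ψ t • w t) - m • c := by
      rw [← hfull ψ hψt w, hm, ← integral_smul_const, ← integral_sub]
      · simp only [smul_sub]
      · exact (integrableOn_iff_integrable_of_support_subset (s := Ioo t₀ tf) (fun t ht => by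
          by_contra hn
          exact ht (by simp [test_eq_zero_of_notMem hψt hn]))).1 (hint ψ hψ.continuous hψc)
      · exact hψi.smul_const c
    rw [e6, ← e5, h0]
  rw [EventuallyEq, ae_restrict_iff' measurableSet_Ioo]
  filter_upwards [key] with t ht ht' using sub_eq_zero.1 (ht ht')

/-! ### Bounds in L^∞ and the integral representation of W^{1,∞} -/

theorem LInf.integrable {t₀ tf : ℝ} {n : ℕ} (v : LInf t₀ tf n) :
    Integrable v (intervalMeasure t₀ tf) :=
  (Lp.memLp v).integrable le_top

theorem LInf.ae_norm_le {t₀ tf : ℝ} {n : ℕ} (v : LInf t₀ tf n) :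
    ∀ᵐ t ∂intervalMeasure t₀ tf, ‖v t‖ ≤ ‖v‖ := by
  have h : ∀ᵐ t ∂intervalMeasure t₀ tf, ‖v t‖ₑ ≤ eLpNorm v ∞ (intervalMeasure t₀ tf) := by
    rw [eLpNorm_exponent_top]
    exact ae_le_eLpNormEssSup
  filter_upwards [h] with t ht
  rw [Lp.norm_def, ← toReal_enorm]
  exact ENNReal.toReal_mono (Lp.eLpNorm_ne_top v) ht

theorem LInf.norm_le {t₀ tf : ℝ} {n : ℕ} {v : LInf t₀ tf n} {c : ℝ} (hc : 0 ≤ c)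
    (h : ∀ᵐ t ∂intervalMeasure t₀ tf, ‖v t‖ ≤ c) : ‖v‖ ≤ c := by
  rw [Lp.norm_def]
  refine ENNReal.toReal_le_of_le_ofReal hc ?_
  have h' := eLpNorm_le_of_ae_bound (p := ∞) h
  simpa using h'

theorem exists_linf_ae_eq {t₀ tf : ℝ} {n : ℕ} {v : ℝ → Vec n} {c : ℝ}
    (hv : AEStronglyMeasurable v (intervalMeasure t₀ tf))
    (hc : ∀ᵐ t ∂intervalMeasure t₀ tf, ‖v t‖ ≤ c) :
    ∃ u : LInf t₀ tf n, u =ᵐ[intervalMeasure t₀ tf] v :=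
  ⟨(memLp_top_of_bound hv c hc).toLp v, MemLp.coeFn_toLp _⟩

/-- The element of `W^{1,∞}(I)^n` with prescribed weak derivative and initial value. -/
theorem W1Inf.exists_of_weakDeriv {t₀ tf : ℝ} (hI : t₀ < tf) {n : ℕ} (v : LInf t₀ tf n)
    (a : Vec n) : ∃ x : W1Inf t₀ tf n, x.weakDeriv = v ∧
      (x.fn =ᵐ[intervalMeasure t₀ tf] fun t => a + ∫ s in t₀..t, v s) ∧
      HasInitialValue x a := by
  have hcont := continuousOn_primitive hI v.integrable a
  obtain ⟨C, hC⟩ := isCompact_Icc.exists_bound_of_continuousOn hcont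
  obtain ⟨y, hy⟩ := exists_linf_ae_eq (t₀ := t₀) (tf := tf)
    (v := fun t => a + ∫ s in t₀..t, v s) (c := C)
    ((hcont.mono Ioo_subset_Icc_self).aestronglyMeasurable measurableSet_Ioo)
    (by
      filter_upwards [ae_restrict_mem measurableSet_Ioo] with t ht
      exact hC t (Ioo_subset_Icc_self ht))
  refine ⟨⟨(y, v), fun φ hφ hc hs => ?_⟩, rfl, hy, _, hcont, hy.symm, by simp⟩
  rw [← integral_deriv_smul_primitive hI v.integrable a hφ hc hs]
  refine integral_congr_ae ?_
  filter_upwards [hy] with t ht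
  simp only [ht]

/-- The a.e. equality says nothing about the endpoint t₀ directly; continuity and density of the
open interval carry it there, which gives initial values a meaning. -/
theorem eqOn_Icc_of_ae_eq {t₀ tf : ℝ} (hI : t₀ < tf) {n : ℕ} {y z : ℝ → Vec n}
    (hy : ContinuousOn y (Icc t₀ tf)) (hz : ContinuousOn z (Icc t₀ tf))
    (h : y =ᵐ[intervalMeasure t₀ tf] z) : EqOn y z (Icc t₀ tf) := by
  have h1 : EqOn y z (Ioo t₀ tf) :=
    Measure.eqOn_open_of_ae_eq h isOpen_Ioo (hy.mono Ioo_subset_Icc_self)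
      (hz.mono Ioo_subset_Icc_self)
  exact h1.of_subset_closure hy hz Ioo_subset_Icc_self (by rw [closure_Ioo hI.ne])

/-- The difference of x and the primitive of its weak derivative has zero weak derivative, so it is
constant by du Bois-Reymond; the continuous representative at t₀ identifies the constant as a. -/
theorem W1Inf.fn_ae_eq {t₀ tf : ℝ} (hI : t₀ < tf) {n : ℕ} {x : W1Inf t₀ tf n} {a : Vec n}
    (hx : HasInitialValue x a) :
    x.fn =ᵐ[intervalMeasure t₀ tf] fun t => a + ∫ s in t₀..t, x.weakDeriv s := by
  have hv : Integrable x.weakDeriv (intervalMeasure t₀ tf) := LInf.integrable _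
  have hcont := continuousOn_primitive hI hv 0
  have hprim : Integrable (fun t => 0 + ∫ s in t₀..t, x.weakDeriv s) (intervalMeasure t₀ tf) :=
    hcont.integrableOn_Icc.mono_set Ioo_subset_Icc_self
  obtain ⟨c, hc⟩ := ae_eq_const_of_integral_deriv_smul_eq_zero hI
    ((LInf.integrable x.fn).sub hprim) (by
      intro φ hφ hcs hs
      have e1 := x.2 φ hφ hcs hs
      have e2 := integral_deriv_smul_primitive hI hv 0 hφ hcs hs
      have hdc := hφ.continuous_deriv (by simp)
      obtain ⟨C, hC⟩ := hdc.bounded_above_of_compact_support hcs.deriv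
      have hi : Integrable (fun t => deriv φ t • (0 + ∫ s in t₀..t, x.weakDeriv s))
          (intervalMeasure t₀ tf) :=
        hprim.bdd_smul C hdc.aestronglyMeasurable (ae_of_all _ hC)
      simp only [Pi.sub_apply, smul_sub]
      rw [integral_sub (integrable_deriv_test_smul x.fn hφ hcs) hi, e2]
      exact sub_eq_zero.2 e1)
  obtain ⟨y, hy, hyx, hya⟩ := hx
  have heq : y =ᵐ[intervalMeasure t₀ tf] fun t => c + ∫ s in t₀..t, x.weakDeriv s := by
    filter_upwards [hyx, hc] with t h1 h2
    simp only [Pi.sub_apply, zero_add] at h2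
    rw [h1, ← h2]
    abel
  have hac : a = c := by
    have := eqOn_Icc_of_ae_eq hI hy (continuousOn_primitive hI hv c) heq (left_mem_Icc.2 hI.le)
    rw [hya] at this
    simpa using this
  rw [hac]
  exact hyx.symm.trans heq

theorem W1Inf.norm_eq {t₀ tf : ℝ} {n : ℕ} (x : W1Inf t₀ tf n) :
    ‖x‖ = max ‖x.fn‖ ‖x.weakDeriv‖ := rfl

theorem W1Inf.norm_fn_le {t₀ tf : ℝ} {n : ℕ} (x : W1Inf t₀ tf n) : ‖x.fn‖ ≤ ‖x‖ :=
  le_max_left _ _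

theorem W1Inf.coeFn_sub {t₀ tf : ℝ} {n : ℕ} (x y : W1Inf t₀ tf n) :
    (∀ᵐ t ∂intervalMeasure t₀ tf, (x - y).fn t = x.fn t - y.fn t) ∧
    ∀ᵐ t ∂intervalMeasure t₀ tf, (x - y).weakDeriv t = x.weakDeriv t - y.weakDeriv t :=
  ⟨Lp.coeFn_sub x.fn y.fn, Lp.coeFn_sub x.weakDeriv y.weakDeriv⟩

theorem W1Inf.coeFn_add {t₀ tf : ℝ} {n : ℕ} (x y : W1Inf t₀ tf n) :
    (∀ᵐ t ∂intervalMeasure t₀ tf, (x + y).fn t = x.fn t + y.fn t) ∧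
    ∀ᵐ t ∂intervalMeasure t₀ tf, (x + y).weakDeriv t = x.weakDeriv t + y.weakDeriv t :=
  ⟨Lp.coeFn_add x.fn y.fn, Lp.coeFn_add x.weakDeriv y.weakDeriv⟩

theorem W1Inf.coeFn_smul {t₀ tf : ℝ} {n : ℕ} (c : ℝ) (x : W1Inf t₀ tf n) :
    (∀ᵐ t ∂intervalMeasure t₀ tf, (c • x).fn t = c • x.fn t) ∧
    ∀ᵐ t ∂intervalMeasure t₀ tf, (c • x).weakDeriv t = c • x.weakDeriv t :=
  ⟨Lp.coeFn_smul c x.fn, Lp.coeFn_smul c x.weakDeriv⟩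

theorem HasInitialValue.sub {t₀ tf : ℝ} {n : ℕ} {x y : W1Inf t₀ tf n} {a b : Vec n}
    (hx : HasInitialValue x a) (hy : HasInitialValue y b) : HasInitialValue (x - y) (a - b) := by
  obtain ⟨u, hu, hux, hua⟩ := hx
  obtain ⟨v, hv, hvy, hvb⟩ := hy
  refine ⟨u - v, hu.sub hv, ?_, by simp [hua, hvb]⟩
  filter_upwards [hux, hvy, (W1Inf.coeFn_sub x y).1] with t h1 h2 h3
  rw [h3, Pi.sub_apply, h1, h2]

theorem HasInitialValue.add {t₀ tf : ℝ} {n : ℕ} {x y : W1Inf t₀ tf n} {a b : Vec n}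
    (hx : HasInitialValue x a) (hy : HasInitialValue y b) : HasInitialValue (x + y) (a + b) := by
  obtain ⟨u, hu, hux, hua⟩ := hx
  obtain ⟨v, hv, hvy, hvb⟩ := hy
  refine ⟨u + v, hu.add hv, ?_, by simp [hua, hvb]⟩
  filter_upwards [hux, hvy, (W1Inf.coeFn_add x y).1] with t h1 h2 h3
  rw [h3, Pi.add_apply, h1, h2]

theorem HasInitialValue.smul {t₀ tf : ℝ} {n : ℕ} {x : W1Inf t₀ tf n} {a : Vec n} (c : ℝ)
    (hx : HasInitialValue x a) : HasInitialValue (c • x) (c • a) := by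
  obtain ⟨u, hu, hux, hua⟩ := hx
  refine ⟨c • u, hu.const_smul c, ?_, by simp [hua]⟩
  filter_upwards [hux, (W1Inf.coeFn_smul c x).1] with t h1 h3
  rw [h3, Pi.smul_apply, h1]

/-! ### Stability -/

/-- A Grönwall estimate in `W^{1,∞}(I)^n`. -/
theorem W1Inf.norm_le_of_weakDeriv_le {t₀ tf : ℝ} (hI : t₀ < tf) {n : ℕ} {L : ℝ} (hL : 0 ≤ L) :
    ∃ C : ℝ, 0 ≤ C ∧ ∀ (z : W1Inf t₀ tf n) (c : ℝ), 0 ≤ c → HasInitialValue z 0 →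
      (∀ᵐ t ∂intervalMeasure t₀ tf, ‖z.weakDeriv t‖ ≤ L * ‖z.fn t‖ + c) → ‖z‖ ≤ C * c := by
  set G := gronwallBound 0 L 1 (tf - t₀) with hG
  have hG0 : 0 ≤ G := by
    have := gronwallBound_mono (δ := 0) (K := L) (ε := 1) le_rfl zero_le_one hL
      (sub_nonneg.2 hI.le)
    rwa [gronwallBound_x0] at this
  have hT : 0 < tf - t₀ := sub_pos.2 hI
  -- With T = tf - t₀, the bounds obtained below are ∫‖y‖ ≤ cTG, then ‖y‖ ≤ (LTG + T)c, then ‖z'‖ ≤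
  -- L‖y‖ + c. The two entries of the maximum bound the function and its weak derivative.
  refine ⟨max (L * (tf - t₀) * G + (tf - t₀)) (L * (L * (tf - t₀) * G + (tf - t₀)) + 1),
    le_max_of_le_left (by positivity), ?_⟩
  intro z c hc hz0 hz
  have hfn := W1Inf.fn_ae_eq hI hz0
  have hvi : Integrable z.weakDeriv (intervalMeasure t₀ tf) := LInf.integrable _
  obtain ⟨v, hv⟩ : ∃ v : ℝ → Vec n, v = z.weakDeriv := ⟨_, rfl⟩
  rw [← hv] at hfn hz hvi
  set y : ℝ → Vec n := fun t => 0 + ∫ s in t₀..t, v s with hy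
  have hyc : ContinuousOn y (Icc t₀ tf) := continuousOn_primitive hI hvi 0
  have hvy : ∀ᵐ t ∂intervalMeasure t₀ tf, ‖v t‖ ≤ L * ‖y t‖ + c := by
    filter_upwards [hz, hfn] with t h1 h2
    rwa [h2] at h1
  set u : ℝ → ℝ := fun t => ‖y t‖ with hu
  have huc : ContinuousOn u (Icc t₀ tf) := hyc.norm
  have hui : Integrable u (intervalMeasure t₀ tf) :=
    huc.integrableOn_Icc.mono_set Ioo_subset_Icc_self
  -- Grönwall is applied to U, not to ‖y‖: y is differentiable only almost everywhere, whereas U has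
  -- right derivative u at every point because u is continuous.
  set U : ℝ → ℝ := fun t => ∫ s in t₀..t, u s with hU
  have hyU : ∀ t ∈ Icc t₀ tf, u t ≤ L * U t + c * (tf - t₀) := by
    intro t ht
    have hut := intervalIntegrable_of_integrable_of_mem hI hui ht
    have h1 : u t ≤ ∫ s in t₀..t, (L * u s + c) := by
      simp only [hu, hy, zero_add]
      refine intervalIntegral.norm_integral_le_of_norm_le ht.1 ?_ ?_
      · have := (ae_restrict_iff' measurableSet_Ioo).1 hvy
        have hne : ∀ᵐ s : ℝ, s ≠ tf := by simp [ae_iff, measure_singleton]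
        filter_upwards [this, hne] with s hs hs' hst
        have := hs ⟨hst.1, lt_of_le_of_ne (hst.2.trans ht.2) hs'⟩
        simpa [hy] using this
      · have := (hut.const_mul L).add (intervalIntegrable_const (c := c))
        simpa [hu, hy] using this
    rw [intervalIntegral.integral_add (hut.const_mul L) intervalIntegrable_const,
      intervalIntegral.integral_const_mul, intervalIntegral.integral_const, smul_eq_mul] at h1
    have h2 : (t - t₀) * c ≤ c * (tf - t₀) := by nlinarith [ht.2]
    exact h1.trans (by simpa [hU] using h2)
  have hU0 : ∀ t ∈ Icc t₀ tf, U t ≤ c * (tf - t₀) * G := by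
    intro t ht
    have hUc : ContinuousOn U (Icc t₀ tf) := by
      simpa [hU] using continuousOn_primitive hI hui 0
    have hUd : ∀ s ∈ Ico t₀ tf, HasDerivWithinAt U (u s) (Ici s) s := by
      intro s hs
      have hcw : ContinuousWithinAt u (Icc t₀ tf) s := huc s (Ico_subset_Icc_self hs)
      refine intervalIntegral.integral_hasDerivWithinAt_right
        (intervalIntegrable_of_integrable_of_mem hI hui (Ico_subset_Icc_self hs))
        (t := Ioi s) ?_ ?_
      · refine ⟨Ioo s tf, Ioo_mem_nhdsGT hs.2, ?_⟩
        exact (hui.mono_measure (Measure.restrict_mono (Ioo_subset_Ioo_left hs.1)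
          le_rfl)).aestronglyMeasurable
      · refine (hcw.mono (Icc_subset_Icc_left hs.1)).mono_of_mem_nhdsWithin ?_
        exact mem_of_superset (Ioo_mem_nhdsGT hs.2) Ioo_subset_Icc_self
    have hUn : ∀ s ∈ Icc t₀ tf, 0 ≤ U s := fun s hs =>
      intervalIntegral.integral_nonneg hs.1 fun _ _ => norm_nonneg _
    have hgr := norm_le_gronwallBound_of_norm_deriv_right_le (δ := 0) (K := L)
      (ε := c * (tf - t₀)) hUc hUd (by simp [hU]) (fun s hs => by
        rw [Real.norm_of_nonneg (norm_nonneg _), Real.norm_of_nonneg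
          (hUn s (Ico_subset_Icc_self hs))]
        exact hyU s (Ico_subset_Icc_self hs)) t ht
    rw [Real.norm_of_nonneg (hUn t ht)] at hgr
    refine hgr.trans ((gronwallBound_mono le_rfl (by positivity) hL
      (sub_le_sub_right ht.2 t₀)).trans (le_of_eq ?_))
    rw [hG]
    -- `gronwallBound` is defined by cases on its rate; with zero initial value it is linear in ε in
    -- both.
    by_cases hL0 : L = 0
    · subst hL0
      simp only [gronwallBound_K0]
      ring
    · simp only [gronwallBound_of_K_ne_0 hL0]
      ring
  have hyb : ∀ t ∈ Icc t₀ tf, ‖y t‖ ≤ (L * (tf - t₀) * G + (tf - t₀)) * c := by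
    intro t ht
    refine (hyU t ht).trans ?_
    have := mul_le_mul_of_nonneg_left (hU0 t ht) hL
    linarith
  have hmem : ∀ᵐ t ∂intervalMeasure t₀ tf, t ∈ Icc t₀ tf := by
    filter_upwards [ae_restrict_mem measurableSet_Ioo] with t ht using Ioo_subset_Icc_self ht
  rw [W1Inf.norm_eq, max_mul_of_nonneg _ _ hc]
  refine max_le_max ?_ ?_
  · refine LInf.norm_le (by positivity) ?_
    filter_upwards [hfn, hmem] with t h1 h2
    rw [h1]
    exact hyb t h2
  · refine LInf.norm_le (by positivity) ?_
    rw [← hv]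
    filter_upwards [hvy, hmem] with t h1 h2
    have := mul_le_mul_of_nonneg_left (hyb t h2) hL
    exact h1.trans (by linarith)

/-! ### Carathéodory functions -/

/-- Replacing y by simple functions makes the composition a finite sum of functions h(·, c) cut off
to measurable sets; continuity of h(t, ·) passes to the limit. -/
theorem aestronglyMeasurable_superposition {α E F : Type*} [MeasurableSpace α] {μ : Measure α}
    [TopologicalSpace E] [MeasurableSpace E] [MeasurableSingletonClass E] [NormedAddCommGroup F]
    {h : α → E → F} (hc : ∀ᵐ t ∂μ, Continuous (h t))
    (hm : ∀ x, AEStronglyMeasurable (fun t => h t x) μ) {y : α → E}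
    (hy : AEStronglyMeasurable y μ) : AEStronglyMeasurable (fun t => h t (y t)) μ := by
  have hsm := hy.stronglyMeasurable_mk
  refine aestronglyMeasurable_of_tendsto_ae atTop (f := fun k t => h t (hsm.approx k t)) ?_ ?_
  · intro k
    set φ := hsm.approx k
    have hφ : (fun t => h t (φ t)) =
        fun t => ∑ c ∈ φ.range, (φ ⁻¹' {c}).indicator (fun t => h t c) t := by
      funext t
      rw [Finset.sum_eq_single_of_mem (φ t) (SimpleFunc.mem_range_self φ t)]
      · rw [indicator_of_mem (by simp)]
      · intro c _ hct
        exact indicator_of_notMem (fun hmem => hct (by simpa using hmem.symm)) _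
    rw [hφ]
    exact Finset.aestronglyMeasurable_fun_sum _ fun c _ =>
      (hm c).indicator (φ.measurableSet_fiber c)
  · filter_upwards [hc, hy.ae_eq_mk] with t h1 h2
    rw [h2]
    exact (h1.tendsto _).comp (hsm.tendsto_approx t)

theorem ae_mem_Icc (t₀ tf : ℝ) : ∀ᵐ t ∂intervalMeasure t₀ tf, t ∈ Icc t₀ tf := by
  filter_upwards [ae_restrict_mem measurableSet_Ioo] with t ht using Ioo_subset_Icc_self ht

theorem integral_congr_of_ae_restrict {E : Type*} [NormedAddCommGroup E] [NormedSpace ℝ E]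
    {t₀ tf t : ℝ} {u v : ℝ → E} (h : u =ᵐ[intervalMeasure t₀ tf] v) (ht : t ∈ Icc t₀ tf) :
    ∫ s in t₀..t, u s = ∫ s in t₀..t, v s := by
  rw [intervalIntegral.integral_of_le ht.1, intervalIntegral.integral_of_le ht.1,
    integral_Ioc_eq_integral_Ioo, integral_Ioc_eq_integral_Ioo]
  exact integral_congr_ae (ae_mono (Measure.restrict_mono (Ioo_subset_Ioo_right ht.2) le_rfl) h)

/-- Integrals over subintervals `(t₀, t)` of an a.e. bounded function. -/
theorem norm_integral_le_of_ae_restrict {E : Type*} [NormedAddCommGroup E] [NormedSpace ℝ E]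
    {t₀ tf t : ℝ} {u : ℝ → E} {b : ℝ → ℝ} (h : ∀ᵐ s ∂intervalMeasure t₀ tf, ‖u s‖ ≤ b s)
    (ht : t ∈ Icc t₀ tf) (hb : IntervalIntegrable b volume t₀ t) :
    ‖∫ s in t₀..t, u s‖ ≤ ∫ s in t₀..t, b s := by
  refine intervalIntegral.norm_integral_le_of_norm_le ht.1 ?_ hb
  have hne : ∀ᵐ s : ℝ, s ≠ tf := by simp [ae_iff, measure_singleton]
  filter_upwards [(ae_restrict_iff' measurableSet_Ioo).1 h, hne] with s hs hs' hst
  exact hs ⟨hst.1, lt_of_le_of_ne (hst.2.trans ht.2) hs'⟩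

theorem integral_exp_shift (a b l : ℝ) :
    ∫ s in a..b, l * Real.exp (l * (s - a)) = Real.exp (l * (b - a)) - 1 := by
  have hd : ∀ s, HasDerivAt (fun s => Real.exp (l * (s - a))) (l * Real.exp (l * (s - a))) s := by
    intro s
    have := (((hasDerivAt_id s).sub_const a).const_mul l).exp
    simpa [mul_comm] using this
  rw [intervalIntegral.integral_eq_sub_of_hasDerivAt (fun s _ => hd s)
    (Continuous.intervalIntegrable (by fun_prop) _ _)]
  simp

/-- A globally Lipschitz Carathéodory differential equation has a continuous solution on `[t₀, t_f]`
in integrated form. -/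
theorem exists_integral_solution {t₀ tf : ℝ} (hI : t₀ < tf) {n : ℕ} {h : ℝ → Vec n → Vec n}
    {L : ℝ} (hL : 0 ≤ L)
    (hLip : ∀ᵐ t ∂intervalMeasure t₀ tf, ∀ x y, ‖h t x - h t y‖ ≤ L * ‖x - y‖)
    (hint : ∀ y : ℝ → Vec n, Continuous y →
      Integrable (fun t => h t (y t)) (intervalMeasure t₀ tf))
    (a : Vec n) : ∃ y : ℝ → Vec n, Continuous y ∧
      ∀ t ∈ Icc t₀ tf, y t = a + ∫ s in t₀..t, h s (y s) := by
  -- Rate of an exponential weight that makes the Picard operator a contraction on an interval of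
  -- any length. The factor 2 gives L ≤ l/2, hence the constant 1/2; the summand 1 keeps l positive
  -- when L = 0.
  set l := 2 * (L + 1) with hl
  have hl0 : 0 < l := by positivity
  -- The unknown z is the solution multiplied by e^{-l(t - t₀)}. `Y` removes the weight and extends
  -- continuously to the line, and `T` is the Picard operator in the weighted unknown.
  let Y : C(Icc t₀ tf, Vec n) → ℝ → Vec n := fun z s =>
    Real.exp (l * (s - t₀)) • IccExtend hI.le z s
  have hY : ∀ z, Continuous (Y z) := fun z => by
    have : Continuous (IccExtend hI.le z) := z.continuous.Icc_extend'
    fun_prop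
  let T : C(Icc t₀ tf, Vec n) → C(Icc t₀ tf, Vec n) := fun z =>
    ⟨fun t => Real.exp (-(l * (t - t₀))) • (a + ∫ s in t₀..t, h s (Y z s)), by
      have h1 := (continuousOn_primitive hI (hint _ (hY z)) a).domRestrict
      have h2 : Continuous fun t : Icc t₀ tf => Real.exp (-(l * ((t : ℝ) - t₀))) := by fun_prop
      exact h2.smul h1⟩
  have hT : ContractingWith (1 / 2) T := by
    refine ⟨by norm_num, LipschitzWith.of_dist_le_mul fun z w => ?_⟩
    rw [ContinuousMap.dist_le (by positivity)]
    intro t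
    set d := dist z w with hd
    have hd0 : 0 ≤ d := dist_nonneg
    have h1 : T z t - T w t =
        Real.exp (-(l * (t - t₀))) • ∫ s in t₀..t, (h s (Y z s) - h s (Y w s)) := by
      rw [intervalIntegral.integral_sub
        (intervalIntegrable_of_integrable_of_mem hI (hint _ (hY z)) t.2)
        (intervalIntegrable_of_integrable_of_mem hI (hint _ (hY w)) t.2)]
      simp only [T, ContinuousMap.coe_mk, ← smul_sub]
      congr 1
      abel
    have h2 : ‖∫ s in t₀..t, (h s (Y z s) - h s (Y w s))‖ ≤
        ∫ s in t₀..t, d / 2 * (l * Real.exp (l * (s - t₀))) := by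
      refine norm_integral_le_of_ae_restrict (tf := tf) ?_ t.2
        (Continuous.intervalIntegrable (by fun_prop) _ _)
      filter_upwards [hLip, ae_mem_Icc t₀ tf] with s hs hsI
      refine (hs _ _).trans ?_
      have h3 : ‖Y z s - Y w s‖ ≤ Real.exp (l * (s - t₀)) * d := by
        simp only [Y, ← smul_sub, norm_smul, Real.norm_of_nonneg (Real.exp_pos _).le]
        refine mul_le_mul_of_nonneg_left ?_ (Real.exp_pos _).le
        rw [← dist_eq_norm]
        exact ContinuousMap.dist_apply_le_dist _
      have h4 : L * ‖Y z s - Y w s‖ ≤ l / 2 * (Real.exp (l * (s - t₀)) * d) :=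
        mul_le_mul (by rw [hl]; linarith) h3 (norm_nonneg _) (by positivity)
      refine h4.trans (le_of_eq (by ring))
    rw [intervalIntegral.integral_const_mul, integral_exp_shift] at h2
    rw [dist_eq_norm, h1, norm_smul, Real.norm_of_nonneg (Real.exp_pos _).le]
    calc Real.exp (-(l * (t - t₀))) * ‖∫ s in t₀..t, (h s (Y z s) - h s (Y w s))‖
        ≤ Real.exp (-(l * (t - t₀))) * (d / 2 * (Real.exp (l * (t - t₀)) - 1)) :=
          mul_le_mul_of_nonneg_left h2 (Real.exp_pos _).le
      _ = d / 2 * (1 - Real.exp (-(l * (t - t₀)))) := by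
          have : Real.exp (-(l * (t - t₀))) * Real.exp (l * (t - t₀)) = 1 := by
            rw [← Real.exp_add]; simp
          linear_combination d / 2 * this
      _ ≤ d / 2 := by
          have := (Real.exp_pos (-(l * ((t : ℝ) - t₀)))).le
          nlinarith
      _ = ((1 / 2 : NNReal) : ℝ) * d := by push_cast; ring
  obtain ⟨z, hz⟩ : ∃ z, T z = z := ⟨_, hT.fixedPoint_isFixedPt⟩
  refine ⟨Y z, hY z, fun t ht => ?_⟩
  have h1 : T z ⟨t, ht⟩ = z ⟨t, ht⟩ := by rw [hz]
  simp only [T, ContinuousMap.coe_mk] at h1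
  have h2 : Y z t = Real.exp (l * (t - t₀)) • z ⟨t, ht⟩ := by
    simp only [Y, IccExtend_of_mem hI.le z ht]
  rw [h2, ← h1, smul_smul, ← Real.exp_add]
  simp

/-- A globally Lipschitz Carathéodory differential equation has a solution in `W^{1,∞}(I)^n`. -/
theorem exists_W1Inf_solution {t₀ tf : ℝ} (hI : t₀ < tf) {n : ℕ} {h : ℝ → Vec n → Vec n}
    {L M : ℝ} (hL : 0 ≤ L)
    (hLip : ∀ᵐ t ∂intervalMeasure t₀ tf, ∀ x y, ‖h t x - h t y‖ ≤ L * ‖x - y‖)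
    (hm : ∀ x, AEStronglyMeasurable (fun t => h t x) (intervalMeasure t₀ tf))
    (hM : ∀ᵐ t ∂intervalMeasure t₀ tf, ‖h t 0‖ ≤ M) (a : Vec n) :
    ∃ x : W1Inf t₀ tf n, (∀ᵐ t ∂intervalMeasure t₀ tf, x.weakDeriv t = h t (x.fn t)) ∧
      HasInitialValue x a := by
  have hcont : ∀ᵐ t ∂intervalMeasure t₀ tf, Continuous (h t) := by
    filter_upwards [hLip] with t ht
    exact (LipschitzWith.of_dist_le_mul (K := ⟨L, hL⟩) fun x y => by
      rw [dist_eq_norm, dist_eq_norm]; exact ht x y).continuous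
  have hmeas : ∀ y : ℝ → Vec n, Continuous y →
      AEStronglyMeasurable (fun t => h t (y t)) (intervalMeasure t₀ tf) := fun y hy =>
    aestronglyMeasurable_superposition hcont hm hy.aestronglyMeasurable
  have hbd : ∀ y : ℝ → Vec n, Continuous y →
      ∃ c, ∀ᵐ t ∂intervalMeasure t₀ tf, ‖h t (y t)‖ ≤ c := by
    intro y hy
    obtain ⟨B, hB⟩ := isCompact_Icc.exists_bound_of_continuousOn (s := Icc t₀ tf) hy.continuousOn
    refine ⟨L * B + M, ?_⟩
    filter_upwards [hLip, hM, ae_mem_Icc t₀ tf] with t h1 h2 h3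
    have h4 := h1 (y t) 0
    rw [sub_zero] at h4
    have h5 := mul_le_mul_of_nonneg_left (hB t h3) hL
    have h6 := norm_sub_norm_le (h t (y t)) (h t 0)
    linarith
  obtain ⟨y, hy, hya⟩ := exists_integral_solution hI hL hLip (fun y hy => by
    obtain ⟨c, hc⟩ := hbd y hy
    exact (memLp_top_of_bound (hmeas y hy) c hc).integrable le_top) a
  obtain ⟨c, hc⟩ := hbd y hy
  obtain ⟨v, hv⟩ := exists_linf_ae_eq (hmeas y hy) hc
  obtain ⟨x, hxv, hxf, hxa⟩ := W1Inf.exists_of_weakDeriv hI v a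
  refine ⟨x, ?_, hxa⟩
  filter_upwards [hv, hxf, ae_mem_Icc t₀ tf] with t h1 h2 h3
  rw [hxv, h1, h2, integral_congr_of_ae_restrict hv h3, ← hya t h3]

/-! ### Bounds for component functions -/

/-- Each derivative order is one summand of the norm. The exceptional null set does not depend on x,
so the bound may be evaluated along a trajectory x(t). -/
theorem ModelFun.ae_norm_iteratedFDeriv_le {t₀ tf : ℝ} {nx ng k : ℕ}
    (g : ModelFun t₀ tf nx ng k) {j : ℕ} (hj : j ≤ k) :
    ∀ᵐ t ∂intervalMeasure t₀ tf, ∀ x, ‖iteratedFDeriv ℝ j (g t) x‖ ≤ ‖g‖ := by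
  filter_upwards [ENNReal.ae_le_essSup (μ := intervalMeasure t₀ tf)
    (fun t => ⨆ x : Vec nx, ‖iteratedFDeriv ℝ j (g t) x‖ₑ)] with t ht x
  have h1 : ‖iteratedFDeriv ℝ j (g t) x‖ₑ ≤ modelENorm t₀ tf k g :=
    ((le_iSup (fun x => ‖iteratedFDeriv ℝ j (g t) x‖ₑ) x).trans ht).trans
      (Finset.single_le_sum (f := fun j => essSup (fun t => ⨆ x : Vec nx,
        ‖iteratedFDeriv ℝ j (g t) x‖ₑ) (intervalMeasure t₀ tf)) (fun _ _ => zero_le)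
        (Finset.mem_range.2 (Nat.lt_succ_iff.2 hj)))
  rw [← toReal_enorm]
  exact ENNReal.toReal_mono g.2.2.2.ne h1

theorem ModelFun.ae_contDiff {t₀ tf : ℝ} {nx ng k : ℕ} (g : ModelFun t₀ tf nx ng k) :
    ∀ᵐ t ∂intervalMeasure t₀ tf, ContDiff ℝ k (g t) := g.2.1

theorem ModelFun.ae_norm_le {t₀ tf : ℝ} {nx ng k : ℕ} (g : ModelFun t₀ tf nx ng k) :
    ∀ᵐ t ∂intervalMeasure t₀ tf, ∀ x, ‖g t x‖ ≤ ‖g‖ := by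
  filter_upwards [g.ae_norm_iteratedFDeriv_le (Nat.zero_le k)] with t ht x
  simpa using ht x

theorem ModelFun.ae_norm_fderiv_le {t₀ tf : ℝ} {nx ng k : ℕ} (hk : 1 ≤ k)
    (g : ModelFun t₀ tf nx ng k) :
    ∀ᵐ t ∂intervalMeasure t₀ tf, ∀ x, ‖fderiv ℝ (g t) x‖ ≤ ‖g‖ := by
  filter_upwards [g.ae_norm_iteratedFDeriv_le hk] with t ht x
  rw [← norm_iteratedFDeriv_one]
  exact ht x

theorem ModelFun.ae_lipschitz {t₀ tf : ℝ} {nx ng k : ℕ} (hk : 1 ≤ k)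
    (g : ModelFun t₀ tf nx ng k) :
    ∀ᵐ t ∂intervalMeasure t₀ tf, ∀ x y, ‖g t x - g t y‖ ≤ ‖g‖ * ‖x - y‖ := by
  filter_upwards [g.ae_norm_fderiv_le hk, g.ae_contDiff] with t ht hc x y
  have hd : Differentiable ℝ (g t) := hc.differentiable (by
    have : k ≠ 0 := by omega
    exact_mod_cast this)
  exact convex_univ.norm_image_sub_le_of_norm_fderiv_le (fun z _ => hd z) (fun z _ => ht z)
    (mem_univ y) (mem_univ x)

/-- The bound on the second derivative in 𝒢² enters here; it makes the remainder of the state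
quadratic. -/
theorem ModelFun.ae_norm_fderiv_sub_le {t₀ tf : ℝ} {nx ng : ℕ} (g : ModelFun t₀ tf nx ng 2) :
    ∀ᵐ t ∂intervalMeasure t₀ tf, ∀ x y,
      ‖fderiv ℝ (g t) x - fderiv ℝ (g t) y‖ ≤ ‖g‖ * ‖x - y‖ := by
  filter_upwards [g.ae_norm_iteratedFDeriv_le le_rfl, g.ae_contDiff] with t ht hc x y
  have hc1 : ContDiff ℝ 1 (fderiv ℝ (g t)) := hc.fderiv_right (by norm_num)
  refine convex_univ.norm_image_sub_le_of_norm_fderiv_le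
    (fun z _ => hc1.differentiable one_ne_zero z) (fun z _ => ?_) (mem_univ y) (mem_univ x)
  rw [← norm_iteratedFDeriv_one, norm_iteratedFDeriv_fderiv]
  exact ht z

/-- First order Taylor estimate under a Lipschitz condition on the derivative. -/
theorem norm_taylor_le_of_fderiv_lipschitz {E F : Type*} [NormedAddCommGroup E] [NormedSpace ℝ E]
    [NormedAddCommGroup F] [NormedSpace ℝ F] {u : E → F} (hu : Differentiable ℝ u) {s : Set E}
    (hs : Convex ℝ s) {L : ℝ} (hL : 0 ≤ L) {x y : E} (hx : x ∈ s) (hy : y ∈ s)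
    (h : ∀ z ∈ s, ‖fderiv ℝ u z - fderiv ℝ u x‖ ≤ L * ‖z - x‖) :
    ‖u y - u x - fderiv ℝ u x (y - x)‖ ≤ L * ‖y - x‖ * ‖y - x‖ := by
  have hs' : Convex ℝ (s ∩ Metric.closedBall x ‖y - x‖) := hs.inter (convex_closedBall _ _)
  refine hs'.norm_image_sub_le_of_norm_fderiv_le' (fun z _ => hu z) (fun z hz => ?_)
    ⟨hx, Metric.mem_closedBall_self (norm_nonneg _)⟩ ⟨hy, by simp [dist_eq_norm]⟩
  refine (h z hz.1).trans (mul_le_mul_of_nonneg_left ?_ hL)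
  rw [← dist_eq_norm]
  exact hz.2

theorem ModelFun.ae_norm_taylor_le {t₀ tf : ℝ} {nx ng : ℕ} (g : ModelFun t₀ tf nx ng 2) :
    ∀ᵐ t ∂intervalMeasure t₀ tf, ∀ x y,
      ‖g t y - g t x - fderiv ℝ (g t) x (y - x)‖ ≤ ‖g‖ * ‖y - x‖ * ‖y - x‖ := by
  filter_upwards [g.ae_norm_fderiv_sub_le, g.ae_contDiff] with t ht hc x y
  exact norm_taylor_le_of_fderiv_lipschitz (hc.differentiable (by norm_num)) convex_univ
    (norm_nonneg g) (mem_univ x) (mem_univ y) fun z _ => ht z x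

theorem ModelFun.sub_apply {t₀ tf : ℝ} {nx ng k : ℕ} (g h : ModelFun t₀ tf nx ng k) (t : ℝ)
    (x : Vec nx) : (g - h) t x = g t x - h t x := rfl

theorem ModelFun.add_apply {t₀ tf : ℝ} {nx ng k : ℕ} (g h : ModelFun t₀ tf nx ng k) (t : ℝ)
    (x : Vec nx) : (g + h) t x = g t x + h t x := rfl

theorem ModelFun.smul_apply {t₀ tf : ℝ} {nx ng k : ℕ} (c : ℝ) (g : ModelFun t₀ tf nx ng k) (t : ℝ)
    (x : Vec nx) : (c • g) t x = c • g t x := rfl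

theorem ModelFun.ae_eq_of_toSpace_eq {t₀ tf : ℝ} {nx ng k : ℕ} {g h : ModelFun t₀ tf nx ng k}
    (e : g.toSpace = h.toSpace) : ∀ᵐ t ∂intervalMeasure t₀ tf, ∀ x, g t x = h t x := by
  have h0 : ‖g - h‖ = 0 := by
    rw [← dist_eq_norm]
    exact Metric.inseparable_iff.1 (SeparationQuotient.mk_eq_mk.1 e)
  filter_upwards [(g - h).ae_norm_le] with t ht x
  have := ht x
  rw [h0, ModelFun.sub_apply] at this
  exact sub_eq_zero.1 (norm_le_zero_iff.1 this)

theorem ModelFun.aestronglyMeasurable_comp {t₀ tf : ℝ} {nx ng k : ℕ}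
    (g : ModelFun t₀ tf nx ng k) {y : ℝ → Vec nx}
    (hy : AEStronglyMeasurable y (intervalMeasure t₀ tf)) :
    AEStronglyMeasurable (fun t => g t (y t)) (intervalMeasure t₀ tf) :=
  aestronglyMeasurable_superposition (g.ae_contDiff.mono fun _ h => h.continuous)
    (fun x => (g.2.2.1 x).aestronglyMeasurable) hy

/-! ### Consequences of the assumptions on the dynamics -/

namespace SmoothDynamics

variable {t₀ tf : ℝ} {nx ng : ℕ} {f : ℝ → Vec nx → Vec ng → Vec nx}

theorem exists_lipschitz (hf : SmoothDynamics t₀ tf f) {R : ℝ} (hR : 0 < R) :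
    ∃ L : ℝ, 0 ≤ L ∧ ∀ᵐ t ∂intervalMeasure t₀ tf,
    ∀ (x₁ x₂ : Vec nx) (g₁ g₂ : Vec ng), ‖x₁‖ ≤ R → ‖x₂‖ ≤ R → ‖g₁‖ ≤ R → ‖g₂‖ ≤ R →
      ‖f t x₁ g₁ - f t x₂ g₂‖ ≤ L * (‖x₁ - x₂‖ + ‖g₁ - g₂‖) := by
  obtain ⟨L, hL⟩ := hf.lipschitz R hR
  refine ⟨max L 0, le_max_right _ _, ?_⟩
  filter_upwards [hL] with t ht x₁ x₂ g₁ g₂ h1 h2 h3 h4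
  exact (ht x₁ x₂ g₁ g₂ h1 h2 h3 h4).trans
    (mul_le_mul_of_nonneg_right (le_max_left _ _) (by positivity))

theorem exists_deriv_lipschitz (hf : SmoothDynamics t₀ tf f) {R : ℝ} (hR : 0 < R) :
    ∃ L : ℝ, 0 ≤ L ∧ ∀ᵐ t ∂intervalMeasure t₀ tf,
    ∀ (x₁ x₂ : Vec nx) (g₁ g₂ : Vec ng), ‖x₁‖ ≤ R → ‖x₂‖ ≤ R → ‖g₁‖ ≤ R → ‖g₂‖ ≤ R →
      ‖fderiv ℝ (fun x => f t x g₁) x₁ - fderiv ℝ (fun x => f t x g₂) x₂‖ +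
        ‖fderiv ℝ (fun g => f t x₁ g) g₁ - fderiv ℝ (fun g => f t x₂ g) g₂‖
      ≤ L * (‖x₁ - x₂‖ + ‖g₁ - g₂‖) := by
  obtain ⟨L, hL⟩ := hf.deriv_lipschitz R hR
  refine ⟨max L 0, le_max_right _ _, ?_⟩
  filter_upwards [hL] with t ht x₁ x₂ g₁ g₂ h1 h2 h3 h4
  exact (ht x₁ x₂ g₁ g₂ h1 h2 h3 h4).trans
    (mul_le_mul_of_nonneg_right (le_max_left _ _) (by positivity))

/-- The growth condition controls the Jacobians at x = 0 only; the Lipschitz condition transports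
the bound to the rest of the ball. -/
theorem exists_deriv_bound (hf : SmoothDynamics t₀ tf f) {R : ℝ} (hR : 0 < R) :
    ∃ M : ℝ, 0 ≤ M ∧ ∀ᵐ t ∂intervalMeasure t₀ tf,
    ∀ (x : Vec nx) (g : Vec ng), ‖x‖ ≤ R → ‖g‖ ≤ R →
      ‖fderiv ℝ (fun x => f t x g) x‖ ≤ M ∧ ‖fderiv ℝ (fun g => f t x g) g‖ ≤ M := by
  obtain ⟨L, hL0, hL⟩ := hf.exists_deriv_lipschitz hR
  obtain ⟨K, hK0, hK⟩ := hf.deriv_growth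
  refine ⟨L * R + K * (R + 1), by positivity, ?_⟩
  filter_upwards [hL, hK] with t h1 h2 x g hx hg
  have h3 := h1 x 0 g g hx (by simpa using hR.le) hg hg
  simp only [sub_self, norm_zero, add_zero, sub_zero] at h3
  have h4 := mul_le_mul_of_nonneg_left hx hL0
  have h5 := mul_le_mul_of_nonneg_left (add_le_add_left hg 1) hK0.le
  obtain ⟨h6, h7⟩ := h2 g
  have h8 := norm_sub_norm_le (fderiv ℝ (fun x => f t x g) x) (fderiv ℝ (fun x => f t x g) 0)
  have h9 := norm_sub_norm_le (fderiv ℝ (fun g => f t x g) g) (fderiv ℝ (fun g => f t 0 g) g)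
  have h10 := norm_nonneg (fderiv ℝ (fun x => f t x g) x - fderiv ℝ (fun x => f t x g) 0)
  have h11 := norm_nonneg (fderiv ℝ (fun g => f t x g) g - fderiv ℝ (fun g => f t 0 g) g)
  constructor <;> linarith

end SmoothDynamics

/-! ### Joint derivative and Taylor expansion of the dynamics -/

theorem fderiv_uncurry_eq {E F G : Type*} [NormedAddCommGroup E] [NormedSpace ℝ E]
    [NormedAddCommGroup F] [NormedSpace ℝ F] [NormedAddCommGroup G] [NormedSpace ℝ G]
    {u : E → F → G} {p : E × F} (hu : DifferentiableAt ℝ (fun p : E × F => u p.1 p.2) p) :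
    fderiv ℝ (fun p : E × F => u p.1 p.2) p =
      (fderiv ℝ (fun x => u x p.2) p.1).coprod (fderiv ℝ (fun y => u p.1 y) p.2) := by
  obtain ⟨x, y⟩ := p
  have h1 := (HasFDerivAt.comp (f := fun x' : E => (x', y)) x hu.hasFDerivAt
    (hasFDerivAt_prodMk_left x y)).fderiv
  have h2 := (HasFDerivAt.comp (f := fun y' : F => (x, y')) y hu.hasFDerivAt
    (hasFDerivAt_prodMk_right x y)).fderiv
  have h1' : fderiv ℝ (fun x => u x y) x = _ := h1
  have h2' : fderiv ℝ (fun y => u x y) y = _ := h2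
  rw [h1', h2']
  ext z <;> simp

theorem hasFDerivAt_comp_uncurry {E F G : Type*} [NormedAddCommGroup E] [NormedSpace ℝ E]
    [NormedAddCommGroup F] [NormedSpace ℝ F] [NormedAddCommGroup G] [NormedSpace ℝ G]
    {u : E → F → G} {w : E → F} {x : E}
    (hu : DifferentiableAt ℝ (fun p : E × F => u p.1 p.2) (x, w x))
    (hw : DifferentiableAt ℝ w x) :
    HasFDerivAt (fun y => u y (w y)) (fderiv ℝ (fun y => u y (w x)) x +
      (fderiv ℝ (fun z => u x z) (w x)).comp (fderiv ℝ w x)) x := by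
  have h := HasFDerivAt.comp (f := fun y => (y, w y)) x hu.hasFDerivAt
    ((hasFDerivAt_id x).prodMk hw.hasFDerivAt)
  rw [fderiv_uncurry_eq hu] at h
  refine h.congr_fderiv ?_
  ext z
  simp

theorem SmoothDynamics.exists_taylor {t₀ tf : ℝ} {nx ng : ℕ} {f : ℝ → Vec nx → Vec ng → Vec nx}
    (hf : SmoothDynamics t₀ tf f) {R : ℝ} (hR : 0 < R) :
    ∃ L : ℝ, 0 ≤ L ∧ ∀ᵐ t ∂intervalMeasure t₀ tf,
    ∀ (x₁ x₂ : Vec nx) (g₁ g₂ : Vec ng), ‖x₁‖ ≤ R → ‖x₂‖ ≤ R → ‖g₁‖ ≤ R → ‖g₂‖ ≤ R →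
      ‖f t x₂ g₂ - f t x₁ g₁ - (fderiv ℝ (fun x => f t x g₁) x₁ (x₂ - x₁) +
        fderiv ℝ (fun g => f t x₁ g) g₁ (g₂ - g₁))‖ ≤ L * (‖x₂ - x₁‖ + ‖g₂ - g₁‖) ^ 2 := by
  obtain ⟨L, hL0, hL⟩ := hf.exists_deriv_lipschitz hR
  -- The joint Jacobian is 2L-Lipschitz: the assumption bounds the sum of the partial differences by
  -- L times a sum of two norms, each at most the maximum norm on the product.
  refine ⟨2 * L, by positivity, ?_⟩
  filter_upwards [hL, hf.contDiff] with t h1 h2 x₁ x₂ g₁ g₂ hx₁ hx₂ hg₁ hg₂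
  have hd : Differentiable ℝ (fun p : Vec nx × Vec ng => f t p.1 p.2) :=
    h2.differentiable one_ne_zero
  have hmem : ∀ (x : Vec nx) (g : Vec ng), ‖x‖ ≤ R → ‖g‖ ≤ R →
      (x, g) ∈ Metric.closedBall (0 : Vec nx × Vec ng) R := fun x g hx hg => by
    rw [mem_closedBall_zero_iff]
    exact max_le hx hg
  have h3 := norm_taylor_le_of_fderiv_lipschitz hd (convex_closedBall 0 R)
    (L := 2 * L) (by positivity) (hmem x₁ g₁ hx₁ hg₁) (hmem x₂ g₂ hx₂ hg₂) (fun z hz => by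
      rw [mem_closedBall_zero_iff] at hz
      have hz1 : ‖z.1‖ ≤ R := (norm_fst_le z).trans hz
      have hz2 : ‖z.2‖ ≤ R := (norm_snd_le z).trans hz
      have h4 := h1 z.1 x₁ z.2 g₁ hz1 hx₁ hz2 hg₁
      have h5 : ‖z.1 - x₁‖ ≤ ‖z - (x₁, g₁)‖ := norm_fst_le (z - (x₁, g₁))
      have h6 : ‖z.2 - g₁‖ ≤ ‖z - (x₁, g₁)‖ := norm_snd_le (z - (x₁, g₁))
      rw [fderiv_uncurry_eq (hd z), fderiv_uncurry_eq (hd (x₁, g₁))]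
      refine ContinuousLinearMap.opNorm_le_bound _ (by positivity) fun w => ?_
      have h7 : ((fderiv ℝ (fun x => f t x z.2) z.1).coprod (fderiv ℝ (fun y => f t z.1 y) z.2) -
          (fderiv ℝ (fun x => f t x g₁) x₁).coprod (fderiv ℝ (fun y => f t x₁ y) g₁)) w =
          (fderiv ℝ (fun x => f t x z.2) z.1 - fderiv ℝ (fun x => f t x g₁) x₁) w.1 +
          (fderiv ℝ (fun y => f t z.1 y) z.2 - fderiv ℝ (fun y => f t x₁ y) g₁) w.2 := by
        simp only [_root_.sub_apply, ContinuousLinearMap.coprod_apply]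
        abel
      rw [h7]
      have h8 := (fderiv ℝ (fun x => f t x z.2) z.1 -
        fderiv ℝ (fun x => f t x g₁) x₁).le_opNorm_of_le (norm_fst_le w)
      have h9 := (fderiv ℝ (fun y => f t z.1 y) z.2 -
        fderiv ℝ (fun y => f t x₁ y) g₁).le_opNorm_of_le (norm_snd_le w)
      refine (norm_add_le_of_le h8 h9).trans ?_
      rw [← add_mul]
      refine mul_le_mul_of_nonneg_right (h4.trans ?_) (norm_nonneg w)
      have := mul_le_mul_of_nonneg_left (add_le_add h5 h6) hL0
      linarith)
  rw [fderiv_uncurry_eq (hd (x₁, g₁))] at h3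
  simp only [Prod.mk_sub_mk, ContinuousLinearMap.coprod_apply] at h3
  refine h3.trans ?_
  have h10 : ‖((x₂ - x₁, g₂ - g₁) : Vec nx × Vec ng)‖ ≤ ‖x₂ - x₁‖ + ‖g₂ - g₁‖ :=
    max_le (le_add_of_nonneg_right (norm_nonneg _)) (le_add_of_nonneg_left (norm_nonneg _))
  rw [mul_assoc, sq]
  exact mul_le_mul_of_nonneg_left (mul_le_mul h10 h10 (norm_nonneg _) (by positivity))
    (by positivity)

theorem SmoothDynamics.aestronglyMeasurable_comp {t₀ tf : ℝ} {nx ng : ℕ}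
    {f : ℝ → Vec nx → Vec ng → Vec nx} (hf : SmoothDynamics t₀ tf f) {x : ℝ → Vec nx}
    {g : ℝ → Vec ng} (hx : AEStronglyMeasurable x (intervalMeasure t₀ tf))
    (hg : AEStronglyMeasurable g (intervalMeasure t₀ tf)) :
    AEStronglyMeasurable (fun t => f t (x t) (g t)) (intervalMeasure t₀ tf) :=
  aestronglyMeasurable_superposition (E := Vec nx × Vec ng) (h := fun t p => f t p.1 p.2)
    (hf.contDiff.mono fun _ h => h.continuous)
    (fun p => (hf.measurable p.1 p.2).aestronglyMeasurable) (hx.prodMk hg)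

/-! ### Truncation -/

/-- The projection of `ℝⁿ` onto the ball of radius `R` of the maximum norm. -/
def clamp {n : ℕ} (R : ℝ) (x : Vec n) : Vec n := fun i => max (-R) (min R (x i))

theorem norm_clamp_le {n : ℕ} {R : ℝ} (hR : 0 ≤ R) (x : Vec n) : ‖clamp R x‖ ≤ R := by
  refine (pi_norm_le_iff_of_nonneg hR).2 fun i => ?_
  rw [Real.norm_eq_abs, abs_le]
  exact ⟨le_max_left _ _, max_le (by linarith) (min_le_left _ _)⟩

theorem clamp_eq_self {n : ℕ} {R : ℝ} {x : Vec n} (hx : ‖x‖ ≤ R) : clamp R x = x := by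
  funext i
  have := abs_le.1 ((norm_le_pi_norm x i).trans hx)
  rw [clamp, min_eq_right this.2, max_eq_right this.1]

theorem norm_clamp_sub_le {n : ℕ} (R : ℝ) (x y : Vec n) : ‖clamp R x - clamp R y‖ ≤ ‖x - y‖ := by
  refine (pi_norm_le_iff_of_nonneg (norm_nonneg _)).2 fun i => ?_
  refine le_trans ?_ (norm_le_pi_norm (x - y) i)
  simp only [clamp, Pi.sub_apply, Real.norm_eq_abs]
  refine (abs_max_sub_max_le_max _ _ _ _).trans (max_le (by simp) ?_)
  exact (abs_min_sub_min_le_max _ _ _ _).trans (max_le (by simp) le_rfl)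

/-! ### Existence, uniqueness and Lipschitz dependence of the state -/

section State

variable {t₀ tf : ℝ} {nx ng : ℕ} {f : ℝ → Vec nx → Vec ng → Vec nx} {x₀ : Vec nx}

theorem W1Inf.ae_norm_fn_le {n : ℕ} (x : W1Inf t₀ tf n) :
    ∀ᵐ t ∂intervalMeasure t₀ tf, ‖x.fn t‖ ≤ ‖x‖ := by
  filter_upwards [LInf.ae_norm_le x.fn] with t ht using ht.trans x.norm_fn_le

theorem W1Inf.eq_of_weakDeriv_sub_le (hI : t₀ < tf) {n : ℕ} {L : ℝ} (hL : 0 ≤ L)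
    {x y : W1Inf t₀ tf n} {a : Vec n} (hx : HasInitialValue x a) (hy : HasInitialValue y a)
    (h : ∀ᵐ t ∂intervalMeasure t₀ tf,
      ‖x.weakDeriv t - y.weakDeriv t‖ ≤ L * ‖x.fn t - y.fn t‖) : x = y := by
  obtain ⟨C, -, hC⟩ := W1Inf.norm_le_of_weakDeriv_le hI (n := n) hL
  have h1 := hC (x - y) 0 le_rfl (by simpa using hx.sub hy) (by
    filter_upwards [h, (W1Inf.coeFn_sub x y).1, (W1Inf.coeFn_sub x y).2] with t h1 h2 h3
    rw [h2, h3, add_zero]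
    exact h1)
  rw [mul_zero] at h1
  exact sub_eq_zero.1 (norm_le_zero_iff.1 h1)

theorem SolvesIVP.unique (hI : t₀ < tf) (hf : SmoothDynamics t₀ tf f) {k : ℕ} (hk : 1 ≤ k)
    {g : ModelFun t₀ tf nx ng k} {x y : W1Inf t₀ tf nx} (hx : SolvesIVP f x₀ g x)
    (hy : SolvesIVP f x₀ g y) : x = y := by
  have hx0 := norm_nonneg x
  have hy0 := norm_nonneg y
  have hg0 := norm_nonneg g
  obtain ⟨L, hL0, hL⟩ := hf.exists_lipschitz (R := ‖x‖ + ‖y‖ + ‖g‖ + 1) (by positivity)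
  refine W1Inf.eq_of_weakDeriv_sub_le hI (L := L * (1 + ‖g‖)) (by positivity) hx.2 hy.2 ?_
  filter_upwards [hL, hx.1, hy.1, x.ae_norm_fn_le, y.ae_norm_fn_le, g.ae_norm_le,
    g.ae_lipschitz hk] with t h1 h2 h3 h4 h5 h6 h7
  rw [h2, h3]
  refine (h1 _ _ _ _ (by linarith) (by linarith) (by linarith [h6 (x.fn t)])
    (by linarith [h6 (y.fn t)])).trans ?_
  rw [mul_assoc]
  refine mul_le_mul_of_nonneg_left ?_ hL0
  linarith [h7 (x.fn t) (y.fn t)]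

theorem norm_le_of_norm_sub_le_one {E : Type*} [SeminormedAddCommGroup E] {g h : E}
    (hgh : ‖g - h‖ ≤ 1) : ‖g‖ ≤ ‖h‖ + 1 := by
  have := norm_sub_norm_le g h
  linarith

/-- The state exists for component functions near a component function for which it exists, and it
depends Lipschitz continuously on the component function there. -/
theorem SolvesIVP.exists_near (hI : t₀ < tf) (hf : SmoothDynamics t₀ tf f) {k : ℕ} (hk : 1 ≤ k)
    {g₁ : ModelFun t₀ tf nx ng k} {x₁ : W1Inf t₀ tf nx} (hx₁ : SolvesIVP f x₀ g₁ x₁) :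
    ∃ C r : ℝ, 0 ≤ C ∧ 0 < r ∧ ∀ g : ModelFun t₀ tf nx ng k, ‖g - g₁‖ < r →
      ∃ x, SolvesIVP f x₀ g x ∧ ‖x - x₁‖ ≤ C * ‖g - g₁‖ := by
  have hx0 := norm_nonneg x₁
  have hg0 := norm_nonneg g₁
  set N := ‖g₁‖ + 1 with hN
  set R := ‖x₁‖ + N + 1 with hR
  obtain ⟨L, hL0, hL⟩ := hf.exists_lipschitz (R := R) (by positivity)
  obtain ⟨K, hK0, hK⟩ := hf.growth
  obtain ⟨C, hC0, hC⟩ := W1Inf.norm_le_of_weakDeriv_le hI (n := nx) (L := L * (1 + N))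
    (by positivity)
  -- Closeness 1 gives ‖g‖ ≤ N; the other radius gives CL‖g - g₁‖ ≤ 1, so that the new state stays
  -- within distance 1 of x₁.
  refine ⟨C * L, min 1 (1 / (C * L + 1)), by positivity, by positivity, fun g hg => ?_⟩
  have hg1 : ‖g - g₁‖ ≤ 1 := hg.le.trans (min_le_left _ _)
  have hgN : ‖g‖ ≤ N := norm_le_of_norm_sub_le_one hg1
  have hsmall : C * (L * ‖g - g₁‖) ≤ 1 := by
    have h1 : ‖g - g₁‖ ≤ 1 / (C * L + 1) := hg.le.trans (min_le_right _ _)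
    rw [le_div_iff₀ (by positivity)] at h1
    nlinarith [norm_nonneg (g - g₁)]
  set ρ := ‖x₁‖ + 1 with hρ
  have hρ0 : 0 ≤ ρ := by positivity
  -- The truncated field has arguments of norm at most R, so the local Lipschitz constant of f
  -- becomes global. Truncation at ρ = ‖x₁‖ + 1 does not alter x₁.
  obtain ⟨x, hx, hxa⟩ := exists_W1Inf_solution hI (L := L * (1 + N)) (M := K * (N + 1))
    (h := fun t y => f t (clamp ρ y) (g t (clamp ρ y))) (by positivity) (by
      filter_upwards [hL, g.ae_norm_le, g.ae_lipschitz hk] with t h1 h2 h3 y z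
      have hy := norm_clamp_le hρ0 y
      have hz := norm_clamp_le hρ0 z
      refine (h1 _ _ _ _ (by linarith) (by linarith) (by linarith [h2 (clamp ρ y)])
        (by linarith [h2 (clamp ρ z)])).trans ?_
      rw [mul_assoc]
      refine mul_le_mul_of_nonneg_left ?_ hL0
      have h4 := norm_clamp_sub_le ρ y z
      have h5 : ‖g‖ * ‖clamp ρ y - clamp ρ z‖ ≤ N * ‖y - z‖ :=
        mul_le_mul hgN h4 (norm_nonneg _) (by positivity)
      linarith [h3 (clamp ρ y) (clamp ρ z)])
    (fun y => hf.aestronglyMeasurable_comp aestronglyMeasurable_const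
      (g.aestronglyMeasurable_comp aestronglyMeasurable_const))
    (by
      filter_upwards [hK, g.ae_norm_le] with t h1 h2
      rw [clamp_eq_self (x := (0 : Vec nx)) (by simpa using hρ0)]
      refine (h1 _).trans (mul_le_mul_of_nonneg_left ?_ hK0.le)
      linarith [h2 0]) x₀
  have hd : ‖x - x₁‖ ≤ C * (L * ‖g - g₁‖) := by
    refine hC (x - x₁) _ (by positivity) (by simpa using hxa.sub hx₁.2) ?_
    filter_upwards [(W1Inf.coeFn_sub x x₁).1, (W1Inf.coeFn_sub x x₁).2, hx, hx₁.1, hL,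
      g.ae_norm_le, g₁.ae_norm_le, g.ae_lipschitz hk, (g - g₁).ae_norm_le, x₁.ae_norm_fn_le]
      with t e1 e2 e3 e4 h1 h2 h3 h4 h5 h6
    rw [e1, e2, e3, e4]
    have hc := norm_clamp_le hρ0 (x.fn t)
    have hc1 : clamp ρ (x₁.fn t) = x₁.fn t := clamp_eq_self (by linarith)
    have h7 := norm_clamp_sub_le ρ (x.fn t) (x₁.fn t)
    rw [hc1] at h7
    refine (h1 _ _ _ _ (by linarith) (by linarith) (by linarith [h2 (clamp ρ (x.fn t))])
      (by linarith [h3 (x₁.fn t)])).trans ?_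
    have h8 := norm_sub_le_norm_sub_add_norm_sub (g t (clamp ρ (x.fn t))) (g t (x₁.fn t))
      (g₁ t (x₁.fn t))
    have h9 : ‖g‖ * ‖clamp ρ (x.fn t) - x₁.fn t‖ ≤ N * ‖x.fn t - x₁.fn t‖ :=
      mul_le_mul hgN h7 (norm_nonneg _) (by positivity)
    have h10 := h5 (x₁.fn t)
    rw [ModelFun.sub_apply] at h10
    have h11 := h4 (clamp ρ (x.fn t)) (x₁.fn t)
    rw [mul_assoc, ← mul_add]
    refine mul_le_mul_of_nonneg_left ?_ hL0
    linarith
  refine ⟨x, ⟨?_, hxa⟩, by rw [mul_assoc]; exact hd⟩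
  filter_upwards [hx, x.ae_norm_fn_le] with t h1 h2
  -- The solution satisfies ‖x‖ ≤ ρ, hence the truncation is inactive along it and it solves the
  -- original equation.
  have h3 := norm_le_of_norm_sub_le_one (hd.trans hsmall)
  rw [h1, clamp_eq_self (by linarith)]

theorem SolvesIVP.congr {k : ℕ} {g h : ModelFun t₀ tf nx ng k} {x : W1Inf t₀ tf nx}
    (hx : SolvesIVP f x₀ g x) (e : g.toSpace = h.toSpace) : SolvesIVP f x₀ h x := by
  refine ⟨?_, hx.2⟩
  filter_upwards [hx.1, ModelFun.ae_eq_of_toSpace_eq e] with t h1 h2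
  rw [h1, h2]

theorem isState_toSpace_iff {k : ℕ} {g : ModelFun t₀ tf nx ng k} {x : W1Inf t₀ tf nx} :
    IsState f x₀ g.toSpace x ↔ SolvesIVP f x₀ g x :=
  ⟨fun ⟨_, e, h⟩ => h.congr e, fun h => ⟨g, rfl, h⟩⟩

theorem state_toSpace_eq (hI : t₀ < tf) (hf : SmoothDynamics t₀ tf f) {k : ℕ} (hk : 1 ≤ k)
    {g : ModelFun t₀ tf nx ng k} {x : W1Inf t₀ tf nx} (hx : SolvesIVP f x₀ g x) :
    state f x₀ g.toSpace = x := by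
  have h : ∃ x, IsState f x₀ g.toSpace x := ⟨x, isState_toSpace_iff.2 hx⟩
  rw [state, dif_pos h]
  exact (isState_toSpace_iff.1 h.choose_spec).unique hI hf hk hx

/-! ### The linearized problem -/

/-- `z` solves `z'(t) = A(t) z(t) + B(t) δ(t)` for almost every `t ∈ I`, `z(t₀) = 0`. -/
def SolvesLinearized {k : ℕ} (f : ℝ → Vec nx → Vec ng → Vec nx) (g : ModelFun t₀ tf nx ng k)
    (x : W1Inf t₀ tf nx) (δ : ℝ → Vec ng) (z : W1Inf t₀ tf nx) : Prop :=
  (∀ᵐ t ∂intervalMeasure t₀ tf,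
    z.weakDeriv t = coeffA f g x t (z.fn t) + coeffB f g x t (δ t)) ∧ HasInitialValue z 0

theorem exists_coeff_bound (hf : SmoothDynamics t₀ tf f) {k : ℕ} (hk : 1 ≤ k)
    (g : ModelFun t₀ tf nx ng k) (x : W1Inf t₀ tf nx) :
    ∃ M : ℝ, 0 ≤ M ∧ ∀ᵐ t ∂intervalMeasure t₀ tf,
      ‖coeffA f g x t‖ ≤ M ∧ ‖coeffB f g x t‖ ≤ M := by
  have hx0 := norm_nonneg x
  have hg0 := norm_nonneg g
  obtain ⟨M, hM0, hM⟩ := hf.exists_deriv_bound (R := ‖x‖ + ‖g‖ + 1) (by positivity)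
  refine ⟨M + M * ‖g‖, by positivity, ?_⟩
  filter_upwards [hM, x.ae_norm_fn_le, g.ae_norm_le, g.ae_norm_fderiv_le hk] with t h1 h2 h3 h4
  obtain ⟨h5, h6⟩ := h1 (x.fn t) (g t (x.fn t)) (by linarith) (by linarith [h3 (x.fn t)])
  refine ⟨norm_add_le_of_le h5 ((ContinuousLinearMap.opNorm_comp_le _ _).trans ?_), ?_⟩
  · exact mul_le_mul h6 (h4 _) (norm_nonneg _) hM0
  · exact h6.trans (le_add_of_nonneg_right (by positivity))

/-- A directional derivative is the limit of the quotients n(u(x + z/n) - u(x)); thus measurability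
of u along curves suffices and none is needed for the Jacobian itself. -/
theorem aestronglyMeasurable_of_hasFDerivAt {α E F : Type*} [MeasurableSpace α] {μ : Measure α}
    [NormedAddCommGroup E] [NormedSpace ℝ E] [NormedAddCommGroup F] [NormedSpace ℝ F]
    {u : α → E → F} {u' : α → E →L[ℝ] F} {x z : α → E}
    (hu : ∀ᵐ t ∂μ, HasFDerivAt (u t) (u' t) (x t))
    (hm : ∀ c : ℝ, AEStronglyMeasurable (fun t => u t (x t + c • z t)) μ) :
    AEStronglyMeasurable (fun t => u' t (z t)) μ := by
  refine aestronglyMeasurable_of_tendsto_ae atTop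
    (f := fun (n : ℕ) t => (n : ℝ) • (u t (x t + (n : ℝ)⁻¹ • z t) - u t (x t))) ?_ ?_
  · intro n
    have h0 := hm 0
    simp only [zero_smul, add_zero] at h0
    exact ((hm _).sub h0).const_smul (n : ℝ)
  · filter_upwards [hu] with t ht
    exact ht.lim (z t) (c := fun n : ℕ => (n : ℝ))
      (by simpa using! tendsto_natCast_atTop_atTop (R := ℝ))

/-- A(t) is the total derivative of y ↦ f(t, y, g(t, y)) at x(t), so its two summands are treated
together. -/
theorem aestronglyMeasurable_coeffA (hf : SmoothDynamics t₀ tf f) {k : ℕ} (hk : 1 ≤ k)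
    (g : ModelFun t₀ tf nx ng k) (x : W1Inf t₀ tf nx) {z : ℝ → Vec nx}
    (hz : AEStronglyMeasurable z (intervalMeasure t₀ tf)) :
    AEStronglyMeasurable (fun t => coeffA f g x t (z t)) (intervalMeasure t₀ tf) := by
  refine aestronglyMeasurable_of_hasFDerivAt (u := fun t y => f t y (g t y)) (x := x.fn) ?_ ?_
  · filter_upwards [hf.contDiff, g.ae_contDiff] with t h1 h2
    exact hasFDerivAt_comp_uncurry (h1.differentiable one_ne_zero _)
      (h2.differentiable (by
        have : k ≠ 0 := by omega
        exact_mod_cast this) _)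
  · intro c
    have h : AEStronglyMeasurable (fun t => x.fn t + c • z t) (intervalMeasure t₀ tf) :=
      (Lp.aestronglyMeasurable x.fn).add (hz.const_smul c)
    exact hf.aestronglyMeasurable_comp h (g.aestronglyMeasurable_comp h)

theorem aestronglyMeasurable_coeffB (hf : SmoothDynamics t₀ tf f) {k : ℕ}
    (g : ModelFun t₀ tf nx ng k) (x : W1Inf t₀ tf nx) {δ : ℝ → Vec ng}
    (hδ : AEStronglyMeasurable δ (intervalMeasure t₀ tf)) :
    AEStronglyMeasurable (fun t => coeffB f g x t (δ t)) (intervalMeasure t₀ tf) := by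
  have hx := Lp.aestronglyMeasurable x.fn
  refine aestronglyMeasurable_of_hasFDerivAt (u := fun t y => f t (x.fn t) y)
    (x := fun t => g t (x.fn t)) ?_ ?_
  · filter_upwards [hf.contDiff] with t h1
    have h2 : DifferentiableAt ℝ (fun y => f t (x.fn t) y) (g t (x.fn t)) :=
      DifferentiableAt.comp (f := fun y : Vec ng => (x.fn t, y)) _
        (h1.differentiable one_ne_zero _) (hasFDerivAt_prodMk_right _ _).differentiableAt
    exact h2.hasFDerivAt
  · intro c
    exact hf.aestronglyMeasurable_comp hx ((g.aestronglyMeasurable_comp hx).add (hδ.const_smul c))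

theorem exists_solvesLinearized (hI : t₀ < tf) (hf : SmoothDynamics t₀ tf f) {k : ℕ} (hk : 1 ≤ k)
    (g : ModelFun t₀ tf nx ng k) (x : W1Inf t₀ tf nx) {δ : ℝ → Vec ng} {c : ℝ}
    (hδ : AEStronglyMeasurable δ (intervalMeasure t₀ tf))
    (hc : ∀ᵐ t ∂intervalMeasure t₀ tf, ‖δ t‖ ≤ c) : ∃ z, SolvesLinearized f g x δ z := by
  obtain ⟨M, hM0, hM⟩ := exists_coeff_bound hf hk g x
  refine exists_W1Inf_solution hI (L := M) (M := M * c)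
    (h := fun t y => coeffA f g x t y + coeffB f g x t (δ t)) hM0 ?_
    (fun y => (aestronglyMeasurable_coeffA hf hk g x aestronglyMeasurable_const).add
      (aestronglyMeasurable_coeffB hf g x hδ)) ?_ 0
  · filter_upwards [hM] with t h1 y z
    rw [add_sub_add_right_eq_sub, ← map_sub]
    exact ContinuousLinearMap.le_of_opNorm_le _ h1.1 _
  · filter_upwards [hM, hc] with t h1 h2
    rw [map_zero, zero_add]
    exact ContinuousLinearMap.le_of_opNorm_le_of_le _ h1.2 h2

theorem SolvesLinearized.unique (hI : t₀ < tf) (hf : SmoothDynamics t₀ tf f) {k : ℕ} (hk : 1 ≤ k)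
    {g : ModelFun t₀ tf nx ng k} {x : W1Inf t₀ tf nx} {δ : ℝ → Vec ng} {y z : W1Inf t₀ tf nx}
    (hy : SolvesLinearized f g x δ y) (hz : SolvesLinearized f g x δ z) : y = z := by
  obtain ⟨M, hM0, hM⟩ := exists_coeff_bound hf hk g x
  refine W1Inf.eq_of_weakDeriv_sub_le hI hM0 hy.2 hz.2 ?_
  filter_upwards [hM, hy.1, hz.1] with t h1 h2 h3
  rw [h2, h3, add_sub_add_right_eq_sub, ← map_sub]
  exact ContinuousLinearMap.le_of_opNorm_le _ h1.1 _

/-- The linearized problem defines a bounded linear operator on `𝒢^k`. -/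
theorem exists_linearizedSolution (hI : t₀ < tf) (hf : SmoothDynamics t₀ tf f) {k : ℕ}
    (hk : 1 ≤ k) (g : ModelFun t₀ tf nx ng k) (x : W1Inf t₀ tf nx) :
    ∃ D : ModelSpace t₀ tf nx ng k →L[ℝ] W1Inf t₀ tf nx, ∀ h : ModelFun t₀ tf nx ng k,
      SolvesLinearized f g x (fun t => h t (x.fn t)) (D h.toSpace) := by
  have hex : ∀ h : ModelFun t₀ tf nx ng k,
      ∃ z, SolvesLinearized f g x (fun t => h t (x.fn t)) z := fun h =>
    exists_solvesLinearized hI hf hk g x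
      (h.aestronglyMeasurable_comp (Lp.aestronglyMeasurable x.fn))
      (h.ae_norm_le.mono fun t ht => ht _)
  choose S hS using hex
  obtain ⟨M, hM0, hM⟩ := exists_coeff_bound hf hk g x
  obtain ⟨C, hC0, hC⟩ := W1Inf.norm_le_of_weakDeriv_le hI (n := nx) hM0
  let S' : ModelFun t₀ tf nx ng k →ₗ[ℝ] W1Inf t₀ tf nx :=
    { toFun := S
      map_add' := fun h₁ h₂ => by
        refine (hS _).unique hI hf hk ⟨?_, by simpa using (hS h₁).2.add (hS h₂).2⟩
        filter_upwards [(hS h₁).1, (hS h₂).1, (W1Inf.coeFn_add (S h₁) (S h₂)).1,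
          (W1Inf.coeFn_add (S h₁) (S h₂)).2] with t e1 e2 e3 e4
        rw [e3, e4, e1, e2, ModelFun.add_apply, map_add, map_add]
        abel
      map_smul' := fun c h => by
        refine (hS _).unique hI hf hk ⟨?_, by simpa using (hS h).2.smul c⟩
        filter_upwards [(hS h).1, (W1Inf.coeFn_smul c (S h)).1,
          (W1Inf.coeFn_smul c (S h)).2] with t e1 e2 e3
        simp only [RingHom.id_apply]
        rw [e2, e3, e1, ModelFun.smul_apply, map_smul, map_smul, smul_add] }
  let S'' : ModelFun t₀ tf nx ng k →L[ℝ] W1Inf t₀ tf nx :=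
    S'.mkContinuous (C * M) fun h => by
      rw [mul_assoc]
      refine hC _ _ (by positivity) (hS h).2 ?_
      filter_upwards [(hS h).1, hM, h.ae_norm_le] with t h1 h2 h3
      refine (congrArg norm h1).trans_le (norm_add_le_of_le
        (ContinuousLinearMap.le_of_opNorm_le _ h2.1 _)
        (ContinuousLinearMap.le_of_opNorm_le_of_le _ h2.2 (h3 _)))
  -- The operator descends to the quotient through a continuous linear choice of representatives;
  -- another representative changes the source term only on a null set of times.
  refine ⟨S''.comp (SeparationQuotient.outCLM ℝ _), fun h => ?_⟩
  obtain ⟨o, ho⟩ : ∃ o, o = SeparationQuotient.outCLM ℝ (ModelFun t₀ tf nx ng k) h.toSpace :=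
    ⟨_, rfl⟩
  have ho' : o.toSpace = h.toSpace := by rw [ho]; exact SeparationQuotient.mk_outCLM ℝ _
  have e : S''.comp (SeparationQuotient.outCLM ℝ _) h.toSpace = S o := by rw [ho]; rfl
  rw [e]
  refine ⟨?_, (hS o).2⟩
  filter_upwards [(hS o).1, ModelFun.ae_eq_of_toSpace_eq ho'] with t h1 h2
  rw [h1, h2]

/-! ### Differentiability of the state -/

/-- Pointwise algebra of the remainder. In the application u = x₁, v = x, w = z, p = g₁(x₁), q =
g(x), r = g₁(x), s is the difference of the two values of f, and `hx`, `hy` are g - g₁ at x₁ and x.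
The error splits into A(x - x₁ - z), the Taylor errors of f and of g₁, and the variation of g - g₁
between x₁ and x. -/
theorem norm_linearization_error_le {E F : Type*} [NormedAddCommGroup E] [NormedSpace ℝ E]
    [NormedAddCommGroup F] [NormedSpace ℝ F] {u v w : E} {p q r : F} {s : E} {hx hy : F}
    {fx : E →L[ℝ] E} {fg : F →L[ℝ] E} {g' : E →L[ℝ] F} {b₁ b₂ b₃ M : ℝ}
    (hT : ‖s - (fx (v - u) + fg (q - p))‖ ≤ b₁) (hG : ‖r - p - g' (v - u)‖ ≤ b₂)
    (hH : ‖hy - hx‖ ≤ b₃) (hq : q - r = hy) (hA : ‖fx + fg.comp g'‖ ≤ M) (hB : ‖fg‖ ≤ M) :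
    ‖s - ((fx + fg.comp g') w + fg hx)‖ ≤ M * ‖v - u - w‖ + (b₁ + M * (b₂ + b₃)) := by
  have e : s - ((fx + fg.comp g') w + fg hx) = (fx + fg.comp g') (v - u - w) +
      ((s - (fx (v - u) + fg (q - p))) + fg ((r - p - g' (v - u)) + (hy - hx))) := by
    rw [← hq]
    simp only [_root_.add_apply, ContinuousLinearMap.comp_apply, map_sub, map_add]
    abel
  rw [e]
  exact norm_add_le_of_le (ContinuousLinearMap.le_of_opNorm_le _ hA _)
    (norm_add_le_of_le hT (ContinuousLinearMap.le_of_opNorm_le_of_le _ hB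
      (norm_add_le_of_le hG hH)))

theorem SolvesIVP.exists_norm_remainder_le (hI : t₀ < tf) (hf : SmoothDynamics t₀ tf f)
    {g₁ : ModelFun t₀ tf nx ng 2} {x₁ : W1Inf t₀ tf nx} (hx₁ : SolvesIVP f x₀ g₁ x₁) :
    ∃ C r : ℝ, 0 < r ∧ ∀ g : ModelFun t₀ tf nx ng 2, ‖g - g₁‖ < r → ∀ x z : W1Inf t₀ tf nx,
      SolvesIVP f x₀ g x → SolvesLinearized f g₁ x₁ (fun t => (g - g₁) t (x₁.fn t)) z →
      ‖x - x₁ - z‖ ≤ C * ‖g - g₁‖ ^ 2 := by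
  obtain ⟨C, r, hC0, hr, hC⟩ := hx₁.exists_near hI hf one_le_two
  have hx0 := norm_nonneg x₁
  have hg0 := norm_nonneg g₁
  set N := ‖g₁‖ + 1 with hN
  have hN0 : 0 ≤ N := by positivity
  set R := ‖x₁‖ + N + 1 with hR
  obtain ⟨L, hL0, hL⟩ := hf.exists_taylor (R := R) (by positivity)
  obtain ⟨M, hM0, hM⟩ := exists_coeff_bound hf one_le_two g₁ x₁
  obtain ⟨C', hC'0, hC'⟩ := W1Inf.norm_le_of_weakDeriv_le hI (n := nx) hM0
  -- The three e² contributions, e = ‖g - g₁‖: Taylor for f with increments Ce and (NC + 1)e, Taylor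
  -- for g₁ with NC²e², and Ce² from e-Lipschitz g - g₁ over distance Ce.
  set B := L * (C + (N * C + 1)) ^ 2 + M * (N * C * C + C) with hB
  have hB0 : 0 ≤ B := by positivity
  refine ⟨C' * B, min r (min 1 (1 / (C + 1))), by positivity, fun g hg x z hx hz => ?_⟩
  obtain ⟨x', hx', hd⟩ := hC g (hg.trans_le (min_le_left _ _))
  -- By uniqueness the given state is the nearby one, so it inherits the Lipschitz estimate.
  obtain rfl := hx'.unique hI hf one_le_two hx
  set e := ‖g - g₁‖ with he
  have he0 : 0 ≤ e := norm_nonneg _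
  have hCe : 0 ≤ C * e := mul_nonneg hC0 he0
  have hNe : 0 ≤ N * (C * e) := mul_nonneg hN0 hCe
  have hgN : ‖g‖ ≤ N := norm_le_of_norm_sub_le_one
    (hg.le.trans ((min_le_right _ _).trans (min_le_left _ _)))
  have hxx : ‖x'‖ ≤ ‖x₁‖ + 1 := by
    refine norm_le_of_norm_sub_le_one (hd.trans ?_)
    have h1 : e ≤ 1 / (C + 1) := hg.le.trans ((min_le_right _ _).trans (min_le_right _ _))
    rw [le_div_iff₀ (add_pos_of_nonneg_of_pos hC0 one_pos)] at h1
    linarith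
  rw [mul_assoc]
  have hi : HasInitialValue (x' - x₁ - z) 0 := by
    have := (hx.2.sub hx₁.2).sub hz.2
    rwa [sub_self, sub_self] at this
  refine hC' _ _ (mul_nonneg hB0 (sq_nonneg e)) hi ?_
  have hdt : ∀ᵐ t ∂intervalMeasure t₀ tf, ‖x'.fn t - x₁.fn t‖ ≤ C * e := by
    filter_upwards [(x' - x₁).ae_norm_fn_le, (W1Inf.coeFn_sub x' x₁).1] with t h1 h2
    rw [← h2]
    exact h1.trans hd
  have hq : ∀ᵐ t ∂intervalMeasure t₀ tf,
      ‖g t (x'.fn t) - g₁ t (x₁.fn t)‖ ≤ (N * C + 1) * e := by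
    filter_upwards [hdt, g.ae_lipschitz one_le_two, (g - g₁).ae_norm_le] with t h1 h2 h3
    have h4 := norm_sub_le_norm_sub_add_norm_sub (g t (x'.fn t)) (g t (x₁.fn t)) (g₁ t (x₁.fn t))
    have h5 : ‖g‖ * ‖x'.fn t - x₁.fn t‖ ≤ N * (C * e) :=
      mul_le_mul hgN h1 (norm_nonneg _) hN0
    have h6 := h3 (x₁.fn t)
    rw [ModelFun.sub_apply] at h6
    linarith [h2 (x'.fn t) (x₁.fn t)]
  have hTay : ∀ᵐ t ∂intervalMeasure t₀ tf,
      ‖f t (x'.fn t) (g t (x'.fn t)) - f t (x₁.fn t) (g₁ t (x₁.fn t)) -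
        (fderiv ℝ (fun y => f t y (g₁ t (x₁.fn t))) (x₁.fn t) (x'.fn t - x₁.fn t) +
          fderiv ℝ (fun y => f t (x₁.fn t) y) (g₁ t (x₁.fn t))
            (g t (x'.fn t) - g₁ t (x₁.fn t)))‖ ≤ L * (C * e + (N * C + 1) * e) ^ 2 := by
    filter_upwards [hL, hdt, hq, x'.ae_norm_fn_le, x₁.ae_norm_fn_le, g.ae_norm_le,
      g₁.ae_norm_le] with t h1 h2 h3 h4 h5 h6 h7
    exact (h1 _ _ _ _ (by linarith) (by linarith) (by linarith [h7 (x₁.fn t)])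
      (by linarith [h6 (x'.fn t)])).trans
      (mul_le_mul_of_nonneg_left (pow_le_pow_left₀ (add_nonneg (norm_nonneg _) (norm_nonneg _)) (add_le_add h2 h3) 2) hL0)
  have hTg : ∀ᵐ t ∂intervalMeasure t₀ tf, ‖g₁ t (x'.fn t) - g₁ t (x₁.fn t) -
      fderiv ℝ (g₁ t) (x₁.fn t) (x'.fn t - x₁.fn t)‖ ≤ N * (C * e) * (C * e) := by
    filter_upwards [hdt, g₁.ae_norm_taylor_le] with t h1 h2
    exact (h2 _ _).trans (mul_le_mul (mul_le_mul (by linarith) h1 (norm_nonneg _) hN0)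
      h1 (norm_nonneg _) hNe)
  have hTh : ∀ᵐ t ∂intervalMeasure t₀ tf,
      ‖(g - g₁) t (x'.fn t) - (g - g₁) t (x₁.fn t)‖ ≤ e * (C * e) := by
    filter_upwards [hdt, (g - g₁).ae_lipschitz one_le_two] with t h1 h2
    exact (h2 _ _).trans (mul_le_mul_of_nonneg_left h1 he0)
  filter_upwards [hM, hx.1, hx₁.1, hz.1, hTay, hTg, hTh, (W1Inf.coeFn_sub x' x₁).1,
    (W1Inf.coeFn_sub x' x₁).2, (W1Inf.coeFn_sub (x' - x₁) z).1, (W1Inf.coeFn_sub (x' - x₁) z).2]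
    with t h2 h3 h4 h5 h6 h7 h8 k1 k2 k3 k4
  rw [k4, k2, k3, k1, h3, h4, h5]
  refine (norm_linearization_error_le (w := z.fn t) h6 h7 h8 rfl h2.1 h2.2).trans
    (le_of_eq ?_)
  rw [hB]
  ring

theorem SolvesIVP.hasFDerivAt_state (hI : t₀ < tf) (hf : SmoothDynamics t₀ tf f)
    {g₁ : ModelFun t₀ tf nx ng 2} {x₁ : W1Inf t₀ tf nx} (hx₁ : SolvesIVP f x₀ g₁ x₁)
    {D : ModelSpace t₀ tf nx ng 2 →L[ℝ] W1Inf t₀ tf nx}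
    (hD : ∀ h : ModelFun t₀ tf nx ng 2,
      SolvesLinearized f g₁ x₁ (fun t => h t (x₁.fn t)) (D h.toSpace)) :
    HasFDerivAt (state f x₀) D g₁.toSpace := by
  obtain ⟨C, r, hr, hC⟩ := hx₁.exists_norm_remainder_le hI hf
  obtain ⟨C', r', -, hr', hC'⟩ := hx₁.exists_near hI hf one_le_two
  have hbig : (fun γ => state f x₀ γ - state f x₀ g₁.toSpace - D (γ - g₁.toSpace))
      =O[𝓝 g₁.toSpace] fun γ => ‖γ - g₁.toSpace‖ ^ 2 := by
    refine Asymptotics.IsBigO.of_bound C ?_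
    -- In this ball the state exists, so `state` never takes its default value 0.
    filter_upwards [Metric.ball_mem_nhds g₁.toSpace (lt_min hr hr')] with γ hγ
    obtain ⟨g, rfl⟩ := SeparationQuotient.surjective_mk γ
    have hn : ‖g.toSpace - g₁.toSpace‖ = ‖g - g₁‖ := SeparationQuotient.norm_mk (g - g₁)
    rw [mem_ball_iff_norm, hn] at hγ
    obtain ⟨x, hx, -⟩ := hC' g (hγ.trans_le (min_le_right _ _))
    have h1 := hC g (hγ.trans_le (min_le_left _ _)) x _ hx (hD (g - g₁))
    rw [state_toSpace_eq hI hf one_le_two hx, state_toSpace_eq hI hf one_le_two hx₁, hn,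
      Real.norm_of_nonneg (by positivity)]
    exact h1
  rw [hasFDerivAt_iff_isLittleO]
  refine hbig.trans_isLittleO ?_
  have h2 : Tendsto (fun γ => γ - g₁.toSpace) (𝓝 g₁.toSpace) (𝓝 0) :=
    tendsto_sub_nhds_zero_iff.2 tendsto_id
  exact ((Asymptotics.isLittleO_norm_pow_id one_lt_two).comp_tendsto h2)

end State

end ModelODE

end

/-! ### The error bound by the optimal control problem -/

open ModelODE in
theorem theorem3p3 {t₀ tf : ℝ} (hI : t₀ < tf) {nx ng : ℕ}
    (f : ℝ → Vec nx → Vec ng → Vec nx) (hf : SmoothDynamics t₀ tf f) (x₀ : Vec nx)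
    (gε gs : ModelFun t₀ tf nx ng 2)
    (xε : W1Inf t₀ tf nx) (hxε : SolvesIVP f x₀ gε xε)
    (Ω : Set (Vec nx)) (hΩ : ∀ᵐ t ∂intervalMeasure t₀ tf, xε.fn t ∈ Ω)
    (ε : ℝ → Vec nx → Vec ng)
    (hε : ∀ᵐ t ∂intervalMeasure t₀ tf, ∀ x ∈ Ω, |gε t x - gs t x| ≤ ε t x)
    (Q : ℝ → Matrix (Fin nx) (Fin nx) ℝ)
    (hQ : ∀ i j, MemLp (fun t => Q t i j) ∞ (intervalMeasure t₀ tf))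
    (hQpsd : ∀ᵐ t ∂intervalMeasure t₀ tf, (Q t).PosSemidef)
    (δ : LInf t₀ tf ng) (δx : W1Inf t₀ tf nx) (hδ : SolvesLQ f gε xε ε Q δ δx) :
    (∀ᶠ γ : ModelSpace t₀ tf nx ng 2 in 𝓝 gε.toSpace, ∃! x, IsState f x₀ γ x) ∧
      DifferentiableAt ℝ (state f x₀) gε.toSpace ∧
      lqObjective Q (fderiv ℝ (state f x₀) gε.toSpace (gε.toSpace - gs.toSpace)) ≤
        lqObjective Q δx := by
  obtain ⟨D, hD⟩ := exists_linearizedSolution hI hf one_le_two gε xε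
  have hder := hxε.hasFDerivAt_state hI hf hD
  refine ⟨?_, hder.differentiableAt, ?_⟩
  · obtain ⟨C, r, -, hr, hC⟩ := hxε.exists_near hI hf one_le_two
    filter_upwards [Metric.ball_mem_nhds gε.toSpace hr] with γ hγ
    obtain ⟨g, rfl⟩ := SeparationQuotient.surjective_mk γ
    have hn : ‖g.toSpace - gε.toSpace‖ = ‖g - gε‖ := SeparationQuotient.norm_mk (g - gε)
    rw [mem_ball_iff_norm, hn] at hγ
    obtain ⟨x, hx, -⟩ := hC g hγ
    exact ⟨x, isState_toSpace_iff.2 hx, fun y hy =>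
      (isState_toSpace_iff.1 hy).unique hI hf one_le_two hx⟩
  · rw [hder.fderiv]
    have hlin := hD (gε - gs)
    obtain ⟨d, hd⟩ := exists_linf_ae_eq
      ((gε - gs).aestronglyMeasurable_comp (Lp.aestronglyMeasurable xε.fn))
      ((gε - gs).ae_norm_le.mono fun t ht => ht (xε.fn t))
    -- The true model error along x_ε is an admissible control, and the Fréchet derivative in its
    -- direction is the corresponding trajectory.
    have hmem : (d, D (gε - gs).toSpace) ∈ lqFeasible f gε xε ε := by
      refine ⟨?_, hlin.2, ?_⟩
      · filter_upwards [hlin.1, hd] with t h1 h2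
        rw [h1, h2]
      · filter_upwards [hε, hΩ, hd] with t h1 h2 h3
        rw [h3]
        have h4 := abs_le'.1 (h1 _ h2)
        exact ⟨neg_le.1 h4.2, h4.1⟩
    exact hδ.2 hmem
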